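/- **Setting.** Let $\mathcal A$ be a finite action set, $\mathcal X$ a covariate space, $d\in\mathbb N$, and let $\mathcal P$ be the law of $(X,(Y(a))_{a\in\mathcal A})$ with $X\in\mathcal X$, $Y(a)\in\mathbb R$; write $\mathcal P_X$ for the law of $X$ and $\mathcal P_{Y\mid X}$ for the conditional law of $(Y(a))_a$ given $X$. Let $\pi(x,\theta)$ ($x\in\mathcal X$, $\theta\in\mathbb R^d$) be a policy (a probability distribution on $\mathcal A$), $w(\theta;x,a)$ a weight and $\ell(\theta;\zeta)$, $\zeta=(x,a,y)$, a loss, all measurable; $\nabla\ell,\nabla^2\ell$ denote derivatives in $\theta$. For $t\ge 1$ the tuples $(X_t,(Y_t(a))_a)$ are i.i.d. with law $\mathcal P$, each independent of the data (including actions) of earlier times; given all data of earlier times and $(X_t,(Y_t(a))_a)$, the action $A_t$ is drawn from $\pi(X_t,\theta_{t-1})$; $\zeta_t=(X_t,A_t,Y_t)$ with $Y_t=Y_t(A_t)$; and, from a deterministic $\theta_0\in\mathbb R^d$, $$\theta_t=\theta_{t-1}-\eta_t w_t\nabla\ell(\theta_{t-1};\zeta_t),\qquad w_t=w(\theta_{t-1};X_t,A_t),$$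 with step sizes $\eta_t>0$, $\sum_t\eta_t=\infty$, $\sum_t\eta_t^2<\infty$ (for instance $\eta_t=\eta_0t^{-\alpha}$, $\eta_0>0$, $\tfrac12<\alpha<1$). Norms are Euclidean for vectors and spectral for matrices. Put $$\mathcal L_{\theta'}(\theta)=\mathbb E\big[w(\theta';X,A)\,\ell(\theta;\zeta)\big],\quad \xi_{\theta'}(\theta;\zeta)=w(\theta';X,A)\nabla\ell(\theta;\zeta)-\nabla\mathcal L_{\theta'}(\theta),$$ where $(X,Y(\cdot))\sim\mathcal P$, $A\sim\pi(X,\theta')$ given $(X,Y(\cdot))$, $\zeta=(X,A,Y(A))$, the expectation is assumed to exist for all $\theta,\theta'$, and $\nabla,\nabla^2$ act on $\theta$. Let $\Delta(x,\theta)=\tfrac12\sum_{a}|\pi(x,\theta)(a)-\pi(x,\theta^*)(a)|$. **Assumptions.** Let $\theta^*\in\mathbb R^d$ and constants $\underline w,\overline w,\delta,\lambda,K$ be such that 1. $0<\underline w<w(\theta;x,a)<\overline w$ for all $\theta,x,a$. 2. For every $\theta'$, $\mathcal L_{\theta'}$ is convex and continuously differentiable on $\mathbb R^d$ and twice continuously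 differentiable at $\theta^*$. Moreover $\delta,\lambda>0$; for all $0<r\le R$, $\inf_{r\le\|\theta-\theta^*\|\le R}\langle\nabla\mathcal L_\theta(\theta),\theta-\theta^*\rangle>0$; and $\langle\nabla\mathcal L_\theta(\theta),\theta-\theta^*\rangle\ge\lambda\|\theta-\theta^*\|^2$ if $\|\theta-\theta^*\|\le\delta$. 3. $\nabla^2\mathcal L_{\theta'}(\theta)$ exists for all $\theta,\theta'$; $H:=\nabla^2\mathcal L_{\theta^*}(\theta^*)$ is positive definite; and $\|\nabla^2\mathcal L_{\theta'}(\theta)-H\|\le K\|\theta-\theta^*\|+K\|\theta'-\theta^*\|$ whenever $\|\theta-\theta^*\|+\|\theta'-\theta^*\|\le2\delta$. 4. There is $\phi\ge0$ on $\mathcal X$ with $0<\mathbb E[\phi(X)]<\infty$ such that, for $\mathcal P_X$-almost every $X$ and all $a,\theta$, $\mathbb E_{\mathcal P_{Y\mid X}}[\|\nabla\ell(\theta;X,a,Y(a))\|^2\mid X]\le\phi(X)(1+\|\theta-\theta^*\|^2)$; and $S:=\mathbb E[\xi_{\theta^*}(\theta^*;\zeta)\xi_{\theta^*}(\theta^*;\zeta)^\top]$,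 with $A\sim\pi(X,\theta^*)$, exists. 5. As $\theta\to\theta^*$: $\mathbb E_{\mathcal P_X}[\Delta(X,\theta)\phi(X)]\to0$; for $\mathcal P_X$-almost every $X$ and all $a$, $\mathbb E_{\mathcal P_{Y\mid X}}[\|\nabla\ell(\theta;X,a,Y(a))-\nabla\ell(\theta^*;X,a,Y(a))\|^2\mid X]\to0$; and for all $a$, $\mathbb E_{\mathcal P_X}[|w(\theta;X,a)-w(\theta^*;X,a)|^2\phi(X)]\to0$. 6. $\nabla^2\ell(\theta;\zeta)$ exists for all $\theta,\zeta$, and there is $\psi\ge0$ on $\mathcal X$ with $\mathbb E[\psi(X)]<\infty$ such that, for $\mathcal P_X$-almost every $X$ and all $a,\theta$, $\mathbb E_{\mathcal P_{Y\mid X}}[\|\nabla^2\ell(\theta;X,a,Y(a))\|^2\mid X]\le\psi(X)(1+\|\theta-\theta^*\|^2)$; and the three limits of 5 hold with $\nabla^2\ell$ in place of $\nabla\ell$ and $\psi$ in place of $\phi$. **Proposition.** Under Assumptions 1–6 the plug-in estimators $$\hat S_n=\frac1n\sum_{t=1}^nw_t^2\,\nabla\ell(\theta_{t-1};\zeta_t)\nabla\ell(\theta_{t-1};\zeta_t)^\top,\qquad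 \hat H_n=\frac1n\sum_{t=1}^nw_t\,\nabla^2\ell(\theta_{t-1};\zeta_t)$$ are consistent: $\hat S_n\to S$ and $\hat H_n\to H$ in probability as $n\to\infty$. -/

import Mathlib

open MeasureTheory ProbabilityTheory Filter Topology
open scoped ENNReal Matrix.Norms.L2Operator

noncomputable section

namespace AdaptiveSGD

/-- The parameter space `ℝ^d` with its Euclidean norm. -/
abbrev Param (d : ℕ) : Type := EuclideanSpace ℝ (Fin d)

/-- The Hessian matrix of `f` at `θ`: entry `(i, j)` is the `j`-th partial derivative of the `i`-th
coordinate of the gradient. The norm on matrices is the spectral norm throughout. -/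
def hessian {d : ℕ} (f : Param d → ℝ) (θ : Param d) : Matrix (Fin d) (Fin d) ℝ :=
  Matrix.of fun i j => (fderiv ℝ (gradient f) θ (EuclideanSpace.single j 1)) i

/-- The matrix `v vᵀ`. -/
def outer {d : ℕ} (v : Param d) : Matrix (Fin d) (Fin d) ℝ :=
  Matrix.of fun i j => v i * v j

/-- A contextual bandit environment with finite action set `𝒜`, a policy, a gradient weight and an
individual loss.
* `env` is the law of `(X, (Y(a))_{a ∈ 𝒜})`;
* `policy (x, θ)` is the distribution of the action given covariate `x` and current estimate `θ`;
* `weight θ x a` is the gradient weight `w(θ; x, a)`;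
* `loss θ (x, a, y)` is the individual loss `ℓ(θ; ζ)` at `ζ = (x, a, y)`. -/
structure Model (d : ℕ) (𝒳 𝒜 : Type*) [MeasurableSpace 𝒳] [MeasurableSpace 𝒜] where
  env : Measure (𝒳 × (𝒜 → ℝ))
  isProbabilityMeasure_env : IsProbabilityMeasure env
  policy : Kernel (𝒳 × Param d) 𝒜
  isMarkovKernel_policy : IsMarkovKernel policy
  weight : Param d → 𝒳 → 𝒜 → ℝ
  measurable_weight : Measurable fun p : Param d × 𝒳 × 𝒜 => weight p.1 p.2.1 p.2.2
  loss : Param d → 𝒳 × 𝒜 × ℝ → ℝ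
  measurable_loss : Measurable fun p : Param d × 𝒳 × 𝒜 × ℝ => loss p.1 p.2

attribute [instance] Model.isProbabilityMeasure_env Model.isMarkovKernel_policy

namespace Model

variable {d : ℕ} {𝒳 𝒜 : Type*} [MeasurableSpace 𝒳] [MeasurableSpace 𝒜]

/-- The stochastic gradient `∇ℓ(θ; ζ)`, with respect to `θ`. -/
def gradLoss (M : Model d 𝒳 𝒜) (θ : Param d) (ζ : 𝒳 × 𝒜 × ℝ) : Param d :=
  gradient (fun ϑ => M.loss ϑ ζ) θ

/-- The stochastic Hessian `∇²ℓ(θ; ζ)`, with respect to `θ`. -/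
def hessLoss (M : Model d 𝒳 𝒜) (θ : Param d) (ζ : 𝒳 × 𝒜 × ℝ) : Matrix (Fin d) (Fin d) ℝ :=
  hessian (fun ϑ => M.loss ϑ ζ) θ

/-- The law of `ζ = (X, A, Y(A))` when `(X, Y(·)) ∼ env` and, given `(X, Y(·))`, the action `A` is
drawn from `policy (X, θ')`. -/
def obsLaw (M : Model d 𝒳 𝒜) (θ' : Param d) : Measure (𝒳 × 𝒜 × ℝ) :=
  (M.env ⊗ₘ Kernel.prodMkRight (𝒜 → ℝ) (M.policy.sectL θ')).map
    fun p => (p.1.1, p.2, p.1.2 p.2)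

/-- The population loss `ℒ_{θ'}(θ) = 𝔼[w(θ'; X, A) ℓ(θ; ζ)]` with `A ∼ π(X, θ')`. -/
def popLoss (M : Model d 𝒳 𝒜) (θ' θ : Param d) : ℝ :=
  ∫ ζ, M.weight θ' ζ.1 ζ.2.1 * M.loss θ ζ ∂(M.obsLaw θ')

/-- `∇ℒ_{θ'}(θ)`, the gradient in `θ`. -/
def gradPopLoss (M : Model d 𝒳 𝒜) (θ' θ : Param d) : Param d :=
  gradient (M.popLoss θ') θ

/-- `∇²ℒ_{θ'}(θ)`, the Hessian in `θ`. -/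
def hessPopLoss (M : Model d 𝒳 𝒜) (θ' θ : Param d) : Matrix (Fin d) (Fin d) ℝ :=
  hessian (M.popLoss θ') θ

/-- `ξ_{θ'}(θ; ζ) = w(θ'; X, A) ∇ℓ(θ; ζ) - ∇ℒ_{θ'}(θ)`. -/
def xi (M : Model d 𝒳 𝒜) (θ' θ : Param d) (ζ : 𝒳 × 𝒜 × ℝ) : Param d :=
  M.weight θ' ζ.1 ζ.2.1 • M.gradLoss θ ζ - M.gradPopLoss θ' θ

/-- `H = ∇²ℒ_{θ*}(θ*)`. -/
def H (M : Model d 𝒳 𝒜) (θstar : Param d) : Matrix (Fin d) (Fin d) ℝ :=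
  M.hessPopLoss θstar θstar

/-- `S = 𝔼[ξ_{θ*}(θ*; ζ) ξ_{θ*}(θ*; ζ)ᵀ]` with `A ∼ π(X, θ*)`, computed entrywise. -/
def S (M : Model d 𝒳 𝒜) (θstar : Param d) : Matrix (Fin d) (Fin d) ℝ :=
  Matrix.of fun i j => ∫ ζ, outer (M.xi θstar θstar ζ) i j ∂(M.obsLaw θstar)

/-- `Δ(x, θ)`, the total variation distance of `π(x, θ)` and `π(x, θ*)`. -/
def tvDist [Fintype 𝒜] (M : Model d 𝒳 𝒜) (θstar : Param d) (x : 𝒳) (θ : Param d) : ℝ :=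
  (1 / 2) * ∑ a, |(M.policy (x, θ)).real {a} - (M.policy (x, θstar)).real {a}|

/-! ### Assumptions

Conditional expectations given `X = x` and `A = a` are integrals against the regular conditional
law `env.condKernel x` of the potential outcomes given `X = x`; statements about the covariate hold
for almost every `x` under the law `env.fst` of `X`. -/

/-- The gradient weight is bounded above and away from zero. -/
structure BoundedWeight (M : Model d 𝒳 𝒜) (wlo whi : ℝ) : Prop where
  pos : 0 < wlo
  lower : ∀ θ x a, wlo < M.weight θ x a
  upper : ∀ θ x a, M.weight θ x a < whi

/-- Regularity of the population loss. `separated` is positivity of `⟨∇ℒ_θ(θ), θ - θ*⟩` for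
`θ ≠ θ*`, uniformly on every compact annulus around `θ*`. -/
structure RegularLoss (M : Model d 𝒳 𝒜) (θstar : Param d) (δ lam : ℝ) : Prop where
  integrable : ∀ θ' θ, Integrable (fun ζ => M.weight θ' ζ.1 ζ.2.1 * M.loss θ ζ) (M.obsLaw θ')
  convex : ∀ θ', ConvexOn ℝ Set.univ (M.popLoss θ')
  contDiff : ∀ θ', ContDiff ℝ 1 (M.popLoss θ')
  twice_contDiffAt : ∀ θ', (∀ᶠ θ in 𝓝 θstar, DifferentiableAt ℝ (M.gradPopLoss θ') θ) ∧
    ContinuousAt (M.hessPopLoss θ') θstar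
  delta_pos : 0 < δ
  lam_pos : 0 < lam
  separated : ∀ r R : ℝ, 0 < r → r ≤ R → ∃ c : ℝ, 0 < c ∧
    ∀ θ, r ≤ ‖θ - θstar‖ → ‖θ - θstar‖ ≤ R → c ≤ inner ℝ (M.gradPopLoss θ θ) (θ - θstar)
  strong : ∀ θ, ‖θ - θstar‖ ≤ δ →
    lam * ‖θ - θstar‖ ^ 2 ≤ inner ℝ (M.gradPopLoss θ θ) (θ - θstar)

/-- The Hessian of the population loss exists, is positive definite at `(θ*, θ*)`, and is
`K`-Lipschitz at `(θ*, θ*)`. -/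
structure RegularHessian (M : Model d 𝒳 𝒜) (θstar : Param d) (δ K : ℝ) : Prop where
  differentiable : ∀ θ', Differentiable ℝ (M.gradPopLoss θ')
  posDef : (M.H θstar).PosDef
  lipschitz : ∀ θ θ', ‖θ - θstar‖ + ‖θ' - θstar‖ ≤ 2 * δ →
    ‖M.hessPopLoss θ' θ - M.hessPopLoss θstar θstar‖ ≤ K * ‖θ - θstar‖ + K * ‖θ' - θstar‖

/-- Second-moment bound on the stochastic gradient, and existence of the Gram matrix. -/
structure GradientMoment [Countable 𝒜] (M : Model d 𝒳 𝒜) (θstar : Param d) (φ : 𝒳 → ℝ) :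
    Prop where
  nonneg : ∀ x, 0 ≤ φ x
  integrable : Integrable φ M.env.fst
  integral_pos : 0 < ∫ x, φ x ∂M.env.fst
  bound : ∀ᵐ x ∂M.env.fst, ∀ a θ,
    ∫⁻ y, ‖M.gradLoss θ (x, a, y a)‖ₑ ^ 2 ∂(M.env.condKernel x) ≤
      ENNReal.ofReal (φ x * (1 + ‖θ - θstar‖ ^ 2))
  gram_exists : ∀ i j, Integrable (fun ζ => outer (M.xi θstar θstar ζ) i j) (M.obsLaw θstar)

/-- Continuity at `θ*` of the policy, of the stochastic gradient and of the weight. -/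
structure GradientContinuity [Fintype 𝒜] (M : Model d 𝒳 𝒜) (θstar : Param d) (φ : 𝒳 → ℝ) :
    Prop where
  tv : Tendsto (fun θ => ∫ x, M.tvDist θstar x θ * φ x ∂M.env.fst) (𝓝 θstar) (𝓝 0)
  grad : ∀ᵐ x ∂M.env.fst, ∀ a, Tendsto
    (fun θ => ∫⁻ y, ‖M.gradLoss θ (x, a, y a) - M.gradLoss θstar (x, a, y a)‖ₑ ^ 2
      ∂(M.env.condKernel x)) (𝓝 θstar) (𝓝 0)
  weight : ∀ a, Tendsto
    (fun θ => ∫ x, |M.weight θ x a - M.weight θstar x a| ^ 2 * φ x ∂M.env.fst) (𝓝 θstar) (𝓝 0)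

/-- The stochastic Hessian exists, has a second-moment bound, and the same continuity conditions
hold with the Hessian in place of the gradient and `ψ` in place of `φ`. -/
structure HessianConditions [Fintype 𝒜] (M : Model d 𝒳 𝒜) (θstar : Param d) (ψ : 𝒳 → ℝ) :
    Prop where
  differentiable_loss : ∀ ζ, Differentiable ℝ fun θ => M.loss θ ζ
  differentiable_grad : ∀ ζ, Differentiable ℝ fun θ => M.gradLoss θ ζ
  nonneg : ∀ x, 0 ≤ ψ x
  integrable : Integrable ψ M.env.fst
  bound : ∀ᵐ x ∂M.env.fst, ∀ a θ,
    ∫⁻ y, ‖M.hessLoss θ (x, a, y a)‖ₑ ^ 2 ∂(M.env.condKernel x) ≤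
      ENNReal.ofReal (ψ x * (1 + ‖θ - θstar‖ ^ 2))
  tv : Tendsto (fun θ => ∫ x, M.tvDist θstar x θ * ψ x ∂M.env.fst) (𝓝 θstar) (𝓝 0)
  hess : ∀ᵐ x ∂M.env.fst, ∀ a, Tendsto
    (fun θ => ∫⁻ y, ‖M.hessLoss θ (x, a, y a) - M.hessLoss θstar (x, a, y a)‖ₑ ^ 2
      ∂(M.env.condKernel x)) (𝓝 θstar) (𝓝 0)
  weight : ∀ a, Tendsto
    (fun θ => ∫ x, |M.weight θ x a - M.weight θstar x a| ^ 2 * ψ x ∂M.env.fst) (𝓝 θstar) (𝓝 0)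

/-! ### The adaptively collected data and the weighted SGD iterates

Data are indexed by `t ≥ 1`; the values at index `0` are never used. -/

variable {Ω : Type*}

/-- The observation `ζ_t = (X_t, A_t, Y_t)` with `Y_t = Y_t(A_t)`. -/
def obs (X : ℕ → Ω → 𝒳) (Y : ℕ → Ω → 𝒜 → ℝ) (A : ℕ → Ω → 𝒜) (t : ℕ) (ω : Ω) : 𝒳 × 𝒜 × ℝ :=
  (X t ω, A t ω, Y t ω (A t ω))

/-- The weighted SGD iterates
`θ_t = θ_{t-1} - η_t w(θ_{t-1}; X_t, A_t) ∇ℓ(θ_{t-1}; ζ_t)` started at `θ₀`. -/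
def sgd (M : Model d 𝒳 𝒜) (η : ℕ → ℝ) (θ₀ : Param d)
    (X : ℕ → Ω → 𝒳) (Y : ℕ → Ω → 𝒜 → ℝ) (A : ℕ → Ω → 𝒜) : ℕ → Ω → Param d
  | 0, _ => θ₀
  | t + 1, ω =>
    sgd M η θ₀ X Y A t ω -
      (η (t + 1) * M.weight (sgd M η θ₀ X Y A t ω) (X (t + 1) ω) (A (t + 1) ω)) •
        M.gradLoss (sgd M η θ₀ X Y A t ω) (obs X Y A (t + 1) ω)

/-- The σ-algebra generated by covariates, actions and all potential outcomes at times
`1, …, t`. -/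
abbrev past (X : ℕ → Ω → 𝒳) (Y : ℕ → Ω → 𝒜 → ℝ) (A : ℕ → Ω → 𝒜) (t : ℕ) : MeasurableSpace Ω :=
  ⨆ s ∈ Finset.Icc 1 t, MeasurableSpace.comap (fun ω => (X s ω, A s ω, Y s ω)) inferInstance

/-- The data are collected adaptively: every `(X_t, Y_t(·))` has law `env` and is independent of the
past (so these tuples are i.i.d.), and given the past and `(X_t, Y_t(·))` the action `A_t` is drawn
from `π(X_t, θ_{t-1})`. -/
structure IsAdaptiveData [MeasurableSpace Ω] (M : Model d 𝒳 𝒜) (η : ℕ → ℝ) (θ₀ : Param d)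
    (μ : Measure Ω) (X : ℕ → Ω → 𝒳) (Y : ℕ → Ω → 𝒜 → ℝ) (A : ℕ → Ω → 𝒜) : Prop where
  measurable_X : ∀ t, Measurable (X t)
  measurable_Y : ∀ t, Measurable (Y t)
  measurable_A : ∀ t, Measurable (A t)
  law : ∀ t, μ.map (fun ω => (X (t + 1) ω, Y (t + 1) ω)) = M.env
  indep : ∀ t, Indep (past X Y A t)
    (MeasurableSpace.comap (fun ω => (X (t + 1) ω, Y (t + 1) ω)) inferInstance) μ
  action : ∀ t a,
    μ[(A (t + 1) ⁻¹' {a}).indicator (fun _ => (1 : ℝ)) | past X Y A t ⊔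
        MeasurableSpace.comap (fun ω => (X (t + 1) ω, Y (t + 1) ω)) inferInstance]
      =ᵐ[μ] fun ω => (M.policy (X (t + 1) ω, M.sgd η θ₀ X Y A t ω)).real {a}

/-- `Ŝ_n = n⁻¹ ∑_{t=1}^n w_t² ∇ℓ(θ_{t-1}; ζ_t) ∇ℓ(θ_{t-1}; ζ_t)ᵀ`; the summation index is
`t - 1`. -/
def Shat (M : Model d 𝒳 𝒜) (η : ℕ → ℝ) (θ₀ : Param d)
    (X : ℕ → Ω → 𝒳) (Y : ℕ → Ω → 𝒜 → ℝ) (A : ℕ → Ω → 𝒜) (n : ℕ) (ω : Ω) :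
    Matrix (Fin d) (Fin d) ℝ :=
  (n : ℝ)⁻¹ • ∑ s ∈ Finset.range n,
    M.weight (M.sgd η θ₀ X Y A s ω) (X (s + 1) ω) (A (s + 1) ω) ^ 2 •
      outer (M.gradLoss (M.sgd η θ₀ X Y A s ω) (obs X Y A (s + 1) ω))

/-- `Ĥ_n = n⁻¹ ∑_{t=1}^n w_t ∇²ℓ(θ_{t-1}; ζ_t)`; the summation index is `t - 1`. -/
def Hhat (M : Model d 𝒳 𝒜) (η : ℕ → ℝ) (θ₀ : Param d)
    (X : ℕ → Ω → 𝒳) (Y : ℕ → Ω → 𝒜 → ℝ) (A : ℕ → Ω → 𝒜) (n : ℕ) (ω : Ω) :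
    Matrix (Fin d) (Fin d) ℝ :=
  (n : ℝ)⁻¹ • ∑ s ∈ Finset.range n,
    M.weight (M.sgd η θ₀ X Y A s ω) (X (s + 1) ω) (A (s + 1) ω) •
      M.hessLoss (M.sgd η θ₀ X Y A s ω) (obs X Y A (s + 1) ω)

end Model

end AdaptiveSGD

end

/-
Given the past, the observation `ζ_t` is drawn from a kernel evaluated at `θ_{t-1}`. A
supermartingale argument of Robbins–Siegmund type shows that the iterates converge to `θ*` almost
surely: the mean squared distance decreases by `2 η_t ⟨∇ℒ_θ(θ), θ - θ*⟩`, up to a summable error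
`C η_t² (1 + ‖θ - θ*‖²)`, and this drift stays away from zero on every annulus around `θ*`.

Whatever the policy, the law of an observation is dominated by the sum over the actions `a` of the
laws of `(X, a, Y(a))`, in whose `L²` the weighted statistics are continuous at `θ*`. So replacing
`θ_{t-1}` by `θ*` in the statistics is asymptotically negligible, the statistic at `θ*` may be
truncated, and for a bounded statistic the fluctuations around the conditional means are orthogonal.
The averages therefore converge to the means at `θ*`.

The limits are `S` and `H` because the mean gradient, which points away from `θ*` on every side,
vanishes at `θ*`, and because the population loss can be differentiated under the integral.
-/

namespace AdaptiveSGD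

section ConvergenceInMeasure

variable {Ω ι : Type*} [MeasurableSpace Ω] {μ : Measure Ω} {l : Filter ι}

lemma tendstoInMeasure_add {E : Type*} [SeminormedAddCommGroup E] {f g : ι → Ω → E}
    {f' g' : Ω → E} (hf : TendstoInMeasure μ f l f') (hg : TendstoInMeasure μ g l g') :
    TendstoInMeasure μ (fun i ω => f i ω + g i ω) l (fun ω => f' ω + g' ω) := by
  intro ε hε
  have h := (hf (ε / 2) (ENNReal.half_pos hε.ne')).add (hg (ε / 2) (ENNReal.half_pos hε.ne'))
  rw [add_zero] at h
  refine tendsto_of_tendsto_of_tendsto_of_le_of_le tendsto_const_nhds h (fun _ => zero_le)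
    fun i => (measure_mono fun ω hω => ?_).trans (measure_union_le _ _)
  by_contra! hlt
  simp only [Set.mem_union, Set.mem_ofPred_eq, not_or, not_le] at hlt hω
  exact absurd (hω.trans (edist_add_add_le _ _ _ _))
    (by simpa only [not_le, ENNReal.add_halves] using ENNReal.add_lt_add hlt.1 hlt.2)

lemma tendstoInMeasure_finset_sum {E κ : Type*} [SeminormedAddCommGroup E] (s : Finset κ)
    {f : κ → ι → Ω → E} {g : κ → Ω → E} (h : ∀ k ∈ s, TendstoInMeasure μ (f k) l (g k)) :
    TendstoInMeasure μ (fun i ω => ∑ k ∈ s, f k i ω) l (fun ω => ∑ k ∈ s, g k ω) := by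
  classical
  induction s using Finset.induction_on with
  | empty =>
    intro ε hε
    simpa [hε.ne'] using tendsto_const_nhds
  | insert k s hk ih =>
    simp only [Finset.sum_insert hk]
    exact tendstoInMeasure_add (h k (Finset.mem_insert_self k s))
      (ih fun j hj => h j (Finset.mem_insert_of_mem hj))

lemma tendstoInMeasure_comp_lipschitz {E F : Type*} [PseudoEMetricSpace E]
    [PseudoEMetricSpace F] {φ : E → F} {K : NNReal} (hφ : LipschitzWith K φ) {f : ι → Ω → E}
    {g : Ω → E} (h : TendstoInMeasure μ f l g) :
    TendstoInMeasure μ (fun i ω => φ (f i ω)) l (fun ω => φ (g ω)) := by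
  intro ε hε
  refine tendsto_of_tendsto_of_tendsto_of_le_of_le tendsto_const_nhds
    (h (ε / K) (ENNReal.div_pos hε.ne' ENNReal.coe_ne_top)) (fun _ => zero_le)
    fun i => measure_mono fun ω hω => ?_
  exact ENNReal.div_le_of_le_mul' (hω.trans (hφ _ _))

lemma tendstoInMeasure_matrix {m n : Type*} [Fintype m] [Fintype n] [DecidableEq n]
    {f : ι → Ω → Matrix m n ℝ} {g : Ω → Matrix m n ℝ}
    (h : ∀ i j, TendstoInMeasure μ (fun k ω => f k ω i j) l fun ω => g ω i j) :
    TendstoInMeasure μ f l g := by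
  classical
  have hsum : ∀ A : Matrix m n ℝ, A = ∑ i, ∑ j, A i j • Matrix.single i j (1 : ℝ) := fun A => by
    conv_lhs => rw [Matrix.matrix_eq_sum_single A]
    simp only [Matrix.smul_single, smul_eq_mul, mul_one]
  have hL : ∀ i j, LipschitzWith ‖Matrix.single i j (1 : ℝ)‖₊
      fun c : ℝ => c • Matrix.single (m := m) (n := n) i j (1 : ℝ) := fun i j =>
    LipschitzWith.of_dist_le_mul fun a b => by
      simp only [dist_eq_norm, ← sub_smul, norm_smul, mul_comm, coe_nnnorm, le_refl]
  have hlim := tendstoInMeasure_finset_sum Finset.univ fun i _ =>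
    tendstoInMeasure_finset_sum Finset.univ fun j _ =>
      tendstoInMeasure_comp_lipschitz (hL i j) (h i j)
  simpa only [← hsum] using hlim

end ConvergenceInMeasure

section Cesaro

variable {Ω : Type*}

/-- The averages `n⁻¹ (u₀ + ⋯ + u_{n-1})` of a sequence of random variables. -/
noncomputable def cesaro (u : ℕ → Ω → ℝ) (n : ℕ) (ω : Ω) : ℝ :=
  (n : ℝ)⁻¹ * ∑ s ∈ Finset.range n, u s ω

lemma cesaro_add (u v : ℕ → Ω → ℝ) (n : ℕ) (ω : Ω) :
    cesaro (fun s ω => u s ω + v s ω) n ω = cesaro u n ω + cesaro v n ω := by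
  simp only [cesaro, Finset.sum_add_distrib, mul_add]

variable [MeasurableSpace Ω] {μ : Measure Ω}

lemma measurable_cesaro {u : ℕ → Ω → ℝ} (hu : ∀ s, Measurable (u s)) (n : ℕ) :
    Measurable (cesaro u n) := by
  unfold cesaro
  fun_prop

lemma lintegral_enorm_cesaro_le {u : ℕ → Ω → ℝ} (hu : ∀ s, Measurable (u s)) {b : ℕ → ℝ}
    (hb : ∀ s, 0 ≤ b s) (h : ∀ s, ∫⁻ ω, ‖u s ω‖ₑ ∂μ ≤ ENNReal.ofReal (b s)) (n : ℕ) :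
    ∫⁻ ω, ‖cesaro u n ω‖ₑ ∂μ ≤ ENNReal.ofReal ((n : ℝ)⁻¹ * ∑ s ∈ Finset.range n, b s) := by
  have hn : 0 ≤ (n : ℝ)⁻¹ := by positivity
  calc ∫⁻ ω, ‖cesaro u n ω‖ₑ ∂μ
      ≤ ∫⁻ ω, ENNReal.ofReal (n : ℝ)⁻¹ * ∑ s ∈ Finset.range n, ‖u s ω‖ₑ ∂μ := by
        refine lintegral_mono fun ω => ?_
        rw [cesaro, enorm_mul, Real.enorm_of_nonneg hn]
        gcongr
        exact enorm_sum_le _ _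
    _ = ENNReal.ofReal (n : ℝ)⁻¹ * ∑ s ∈ Finset.range n, ∫⁻ ω, ‖u s ω‖ₑ ∂μ := by
        rw [lintegral_const_mul' _ _ ENNReal.ofReal_ne_top,
          lintegral_finsetSum _ fun s _ => (hu s).enorm]
    _ ≤ ENNReal.ofReal (n : ℝ)⁻¹ * ∑ s ∈ Finset.range n, ENNReal.ofReal (b s) := by
        gcongr with s
        exact h s
    _ = _ := by rw [ENNReal.ofReal_mul hn, ENNReal.ofReal_sum_of_nonneg fun s _ => hb s]

lemma tendsto_lintegral_enorm_cesaro {u : ℕ → Ω → ℝ} (hu : ∀ s, Measurable (u s))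
    {b : ℕ → ℝ} (hb : ∀ s, 0 ≤ b s) (h : ∀ s, ∫⁻ ω, ‖u s ω‖ₑ ∂μ ≤ ENNReal.ofReal (b s))
    (hlim : Tendsto b atTop (𝓝 0)) :
    Tendsto (fun n => ∫⁻ ω, ‖cesaro u n ω‖ₑ ∂μ) atTop (𝓝 0) := by
  refine tendsto_of_tendsto_of_tendsto_of_le_of_le tendsto_const_nhds ?_ (fun _ => zero_le)
    (lintegral_enorm_cesaro_le hu hb h)
  simpa only [ENNReal.ofReal_zero] using ENNReal.tendsto_ofReal hlim.cesaro

lemma tendsto_lintegral_enorm_cesaro_of_approx {u : ℕ → Ω → ℝ} (hu : ∀ s, Measurable (u s))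
    (h : ∀ ε : NNReal, 0 < ε → ∃ v : ℕ → Ω → ℝ, (∀ s, Measurable (v s)) ∧
      (∀ s, ∫⁻ ω, ‖u s ω - v s ω‖ₑ ∂μ ≤ ε) ∧
      Tendsto (fun n => ∫⁻ ω, ‖cesaro v n ω‖ₑ ∂μ) atTop (𝓝 0)) :
    Tendsto (fun n => ∫⁻ ω, ‖cesaro u n ω‖ₑ ∂μ) atTop (𝓝 0) := by
  refine ENNReal.tendsto_nhds_zero.2 fun ε hε => ?_
  obtain ⟨δ, hδ, hδε⟩ := ENNReal.lt_iff_exists_nnreal_btwn.1 (ENNReal.half_pos hε.ne')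
  obtain ⟨v, hv, huv, hlim⟩ := h δ (by exact_mod_cast hδ)
  have hrest : ∀ n, ∫⁻ ω, ‖cesaro (fun s ω => u s ω - v s ω) n ω‖ₑ ∂μ ≤ ε / 2 := fun n => by
    refine (lintegral_enorm_cesaro_le (b := fun _ => δ) (fun s => (hu s).sub (hv s))
      (fun _ => δ.2) (fun s => by simpa using huv s) n).trans (le_trans ?_ hδε.le)
    rw [← ENNReal.ofReal_coe_nnreal, Finset.sum_const, Finset.card_range, nsmul_eq_mul,
      ← mul_assoc]
    exact ENNReal.ofReal_le_ofReal (mul_le_of_le_one_left δ.2 inv_mul_le_one)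
  filter_upwards [ENNReal.tendsto_nhds_zero.1 hlim _ (ENNReal.half_pos hε.ne')] with n hn
  calc ∫⁻ ω, ‖cesaro u n ω‖ₑ ∂μ
      ≤ ∫⁻ ω, ‖cesaro v n ω‖ₑ + ‖cesaro (fun s ω => u s ω - v s ω) n ω‖ₑ ∂μ := by
        refine lintegral_mono fun ω => ?_
        have hsplit := cesaro_add v (fun s ω => u s ω - v s ω) n ω
        simp only [add_sub_cancel] at hsplit
        exact hsplit ▸ enorm_add_le _ _
    _ = ∫⁻ ω, ‖cesaro v n ω‖ₑ ∂μ + ∫⁻ ω, ‖cesaro (fun s ω => u s ω - v s ω) n ω‖ₑ ∂μ :=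
        lintegral_add_left (measurable_cesaro hv n).enorm _
    _ ≤ ε / 2 + ε / 2 := add_le_add hn (hrest n)
    _ = ε := ENNReal.add_halves ε

lemma tendstoInMeasure_of_tendsto_lintegral_enorm {u : ℕ → Ω → ℝ} (hu : ∀ n, Measurable (u n))
    (h : Tendsto (fun n => ∫⁻ ω, ‖u n ω‖ₑ ∂μ) atTop (𝓝 0)) :
    TendstoInMeasure μ u atTop fun _ => 0 := by
  refine tendstoInMeasure_of_tendsto_eLpNorm one_ne_zero
    (fun n => (hu n).aestronglyMeasurable) aestronglyMeasurable_const ?_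
  simpa only [eLpNorm_one_eq_lintegral_enorm, Pi.sub_apply, sub_zero] using h

lemma tendstoInMeasure_cesaro_of_tendsto_ae [IsFiniteMeasure μ] {u : ℕ → Ω → ℝ}
    (hu : ∀ s, Measurable (u s)) {c : ℝ}
    (h : ∀ᵐ ω ∂μ, Tendsto (fun s => u s ω) atTop (𝓝 c)) :
    TendstoInMeasure μ (cesaro u) atTop fun _ => c :=
  tendstoInMeasure_of_tendsto_ae (fun n => (measurable_cesaro hu n).aestronglyMeasurable)
    (h.mono fun _ hω => hω.cesaro)

end Cesaro

section MartingaleDifference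

variable {Ω : Type*} {m0 : MeasurableSpace Ω} {μ : Measure Ω} [IsProbabilityMeasure μ]
  {ℱ : Filtration ℕ m0} {D : ℕ → Ω → ℝ} {B : ℝ}

lemma integral_sq_sum_le_of_condExp_eq_zero (hD : ∀ s, Measurable[ℱ (s + 1)] (D s))
    (hB : ∀ s ω, |D s ω| ≤ B) (h0 : ∀ s, μ[D s | ℱ s] =ᵐ[μ] 0) (n : ℕ) :
    ∫ ω, (∑ s ∈ Finset.range n, D s ω) ^ 2 ∂μ ≤ n * B ^ 2 := by
  have hDm : ∀ s, Measurable (D s) := fun s => (hD s).mono (ℱ.le _) le_rfl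
  have hD2 : ∀ s, MemLp (D s) 2 μ := fun s =>
    MemLp.of_bound (hDm s).aestronglyMeasurable B (ae_of_all _ fun ω => hB s ω)
  induction n with
  | zero => simp
  | succ n ih =>
    set T : Ω → ℝ := fun ω => ∑ s ∈ Finset.range n, D s ω
    have hTm : Measurable[ℱ n] T := Finset.measurable_fun_sum _ fun s hs =>
      (hD s).mono (ℱ.mono (Finset.mem_range.1 hs)) le_rfl
    have hT2 : MemLp T 2 μ := memLp_finsetSum _ fun s _ => hD2 s
    have hTD : Integrable (fun ω => T ω * D n ω) μ := hT2.integrable_mul (hD2 n)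
    have horth : ∫ ω, T ω * D n ω ∂μ = 0 := by
      have hpull := condExp_mul_of_stronglyMeasurable_left hTm.stronglyMeasurable hTD
        ((hD2 n).integrable one_le_two)
      rw [← integral_condExp (ℱ.le n)]
      refine integral_eq_zero_of_ae ?_
      filter_upwards [hpull, h0 n] with ω h1 h2
      exact h1.trans (by rw [Pi.mul_apply, h2, Pi.zero_apply, mul_zero])
    have hexp : ∀ ω, (∑ s ∈ Finset.range (n + 1), D s ω) ^ 2
        = T ω ^ 2 + 2 * (T ω * D n ω) + D n ω ^ 2 := fun ω => by
      rw [Finset.sum_range_succ]; ring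
    have hlast : ∫ ω, D n ω ^ 2 ∂μ ≤ B ^ 2 := by
      refine (integral_mono (hD2 n).integrable_sq (integrable_const (B ^ 2)) fun ω =>
        sq_le_sq.2 ((hB n ω).trans (le_abs_self B))).trans_eq (by simp)
    have hint : Integrable (fun ω => T ω ^ 2 + 2 * (T ω * D n ω)) μ :=
      hT2.integrable_sq.add (hTD.const_mul 2)
    simp_rw [hexp]
    rw [integral_add hint (hD2 n).integrable_sq,
      integral_add hT2.integrable_sq (hTD.const_mul 2), integral_const_mul, horth]
    push_cast
    linarith

lemma lintegral_enorm_cesaro_le_of_condExp_eq_zero (hD : ∀ s, Measurable[ℱ (s + 1)] (D s))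
    (hB : ∀ s ω, |D s ω| ≤ B) (h0 : ∀ s, μ[D s | ℱ s] =ᵐ[μ] 0) (n : ℕ) :
    ∫⁻ ω, ‖cesaro D n ω‖ₑ ∂μ ≤ ENNReal.ofReal √((n : ℝ)⁻¹ * B ^ 2) := by
  have hDm : ∀ s, Measurable (D s) := fun s => (hD s).mono (ℱ.le _) le_rfl
  have hsum : MemLp (fun ω => ∑ s ∈ Finset.range n, D s ω) 2 μ := memLp_finsetSum _ fun s _ =>
    MemLp.of_bound (hDm s).aestronglyMeasurable B (ae_of_all _ fun ω => hB s ω)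
  have hc : MemLp (cesaro D n) 2 μ := hsum.const_mul _
  have hsq : ∫ ω, cesaro D n ω ^ 2 ∂μ ≤ (n : ℝ)⁻¹ * B ^ 2 := by
    simp only [cesaro, mul_pow]
    rw [integral_const_mul]
    calc (n : ℝ)⁻¹ ^ 2 * ∫ ω, (∑ s ∈ Finset.range n, D s ω) ^ 2 ∂μ
        ≤ (n : ℝ)⁻¹ ^ 2 * (n * B ^ 2) := by
          gcongr
          exact integral_sq_sum_le_of_condExp_eq_zero hD hB h0 n
      _ = (n : ℝ)⁻¹ * B ^ 2 := by
          rcases eq_or_ne (n : ℝ) 0 with hn | hn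
          · simp [hn]
          · field_simp
  have hvar := variance_nonneg (fun ω => ‖cesaro D n ω‖) μ
  rw [variance_eq_sub hc.norm] at hvar
  simp only [Pi.pow_apply, Real.norm_eq_abs, sq_abs] at hvar
  rw [← ofReal_integral_norm_eq_lintegral_enorm (hc.integrable one_le_two)]
  refine ENNReal.ofReal_le_ofReal (Real.le_sqrt_of_sq_le ?_)
  simp only [Real.norm_eq_abs]
  linarith

lemma tendsto_lintegral_enorm_cesaro_of_condExp_eq_zero (hD : ∀ s, Measurable[ℱ (s + 1)] (D s))
    (hB : ∀ s ω, |D s ω| ≤ B) (h0 : ∀ s, μ[D s | ℱ s] =ᵐ[μ] 0) :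
    Tendsto (fun n => ∫⁻ ω, ‖cesaro D n ω‖ₑ ∂μ) atTop (𝓝 0) := by
  refine tendsto_of_tendsto_of_tendsto_of_le_of_le tendsto_const_nhds ?_ (fun _ => zero_le)
    (lintegral_enorm_cesaro_le_of_condExp_eq_zero hD hB h0)
  have h := ((tendsto_inv_atTop_nhds_zero_nat (𝕜 := ℝ)).mul_const (B ^ 2)).sqrt
  simpa only [zero_mul, Real.sqrt_zero, ENNReal.ofReal_zero] using ENNReal.tendsto_ofReal h

end MartingaleDifference

section KernelDriven

variable {Ω P Z : Type*} {m0 : MeasurableSpace Ω} [MeasurableSpace P] [MeasurableSpace Z]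

/-- The sequence `ζ` is driven by the adapted sequence `θ` through the kernel `κ`: given `ℱ t`, the
law of `ζ t` is `κ (θ t)`. The conditional law is encoded by the joint law of `(θ t, ζ t)` on every
event of `ℱ t`. -/
structure IsKernelDriven (μ : Measure Ω) (ℱ : Filtration ℕ m0) (θ : ℕ → Ω → P) (ζ : ℕ → Ω → Z)
    (κ : Kernel P Z) : Prop where
  measurable_param : ∀ t, Measurable[ℱ t] (θ t)
  measurable_obs : ∀ t, Measurable[ℱ (t + 1)] (ζ t)
  law : ∀ t s, MeasurableSet[ℱ t] s →
    (μ.restrict s).map (fun ω => (θ t ω, ζ t ω)) = (μ.restrict s).map (θ t) ⊗ₘ κ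

namespace IsKernelDriven

variable {μ : Measure Ω} {ℱ : Filtration ℕ m0} {θ : ℕ → Ω → P} {ζ : ℕ → Ω → Z} {κ : Kernel P Z}

lemma measurable_param' (h : IsKernelDriven μ ℱ θ ζ κ) (t : ℕ) : Measurable (θ t) :=
  (h.measurable_param t).mono (ℱ.le t) le_rfl

lemma measurable_pair (h : IsKernelDriven μ ℱ θ ζ κ) (t : ℕ) :
    Measurable[ℱ (t + 1)] fun ω => (θ t ω, ζ t ω) :=
  ((h.measurable_param t).mono (ℱ.mono t.le_succ) le_rfl).prodMk (h.measurable_obs t)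

lemma measurable_pair' (h : IsKernelDriven μ ℱ θ ζ κ) (t : ℕ) :
    Measurable fun ω => (θ t ω, ζ t ω) :=
  (h.measurable_pair t).mono (ℱ.le (t + 1)) le_rfl

section CondExp

variable [IsFiniteMeasure μ] [IsSFiniteKernel κ]

lemma lintegral_eq (h : IsKernelDriven μ ℱ θ ζ κ) (t : ℕ) {f : P × Z → ℝ≥0∞}
    (hf : Measurable f) :
    ∫⁻ ω, f (θ t ω, ζ t ω) ∂μ = ∫⁻ ω, ∫⁻ z, f (θ t ω, z) ∂(κ (θ t ω)) ∂μ := by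
  have hlaw := h.law t Set.univ MeasurableSet.univ
  rw [Measure.restrict_univ] at hlaw
  rw [← lintegral_map hf (h.measurable_pair' t), hlaw, Measure.lintegral_compProd hf,
    lintegral_map hf.lintegral_kernel_prod_right' (h.measurable_param' t)]

theorem condExp_ae_eq (h : IsKernelDriven μ ℱ θ ζ κ) (t : ℕ) {f : P × Z → ℝ}
    (hf : Measurable f) (hint : Integrable (fun ω => f (θ t ω, ζ t ω)) μ) :
    μ[fun ω => f (θ t ω, ζ t ω) | ℱ t] =ᵐ[μ] fun ω => ∫ z, f (θ t ω, z) ∂(κ (θ t ω)) := by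
  have hsm : StronglyMeasurable fun p => ∫ z, f (p, z) ∂(κ p) :=
    StronglyMeasurable.integral_kernel_prod_right' hf.stronglyMeasurable
  have hlaw : ∀ s, MeasurableSet[ℱ t] s →
      Integrable f ((μ.restrict s).map (θ t) ⊗ₘ κ) := fun s hs => by
    rw [← h.law t s hs, integrable_map_measure hf.aestronglyMeasurable
      (h.measurable_pair' t).aemeasurable]
    exact hint.mono_measure Measure.restrict_le_self
  refine (ae_eq_condExp_of_forall_setIntegral_eq (ℱ.le t) hint (fun s hs _ => ?_)
    (fun s hs _ => ?_) ?_).symm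
  · exact (integrable_map_measure hsm.aestronglyMeasurable (h.measurable_param' t).aemeasurable).1
      (hlaw s hs).integral_compProd
  · rw [← integral_map (h.measurable_param' t).aemeasurable hsm.aestronglyMeasurable,
      ← Measure.integral_compProd (hlaw s hs), ← h.law t s hs,
      integral_map (h.measurable_pair' t).aemeasurable hf.aestronglyMeasurable]
  · exact (hsm.comp_measurable (h.measurable_param t)).aestronglyMeasurable

end CondExp

section Average

variable [IsProbabilityMeasure μ] [IsMarkovKernel κ]

lemma tendsto_lintegral_enorm_cesaro_sub_of_bounded
    (h : IsKernelDriven μ ℱ θ ζ κ) {g : Z → ℝ} (hg : Measurable g) {B : ℝ}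
    (hB : ∀ z, |g z| ≤ B) :
    Tendsto (fun n => ∫⁻ ω, ‖cesaro (fun s ω => g (ζ s ω) - ∫ z, g z ∂(κ (θ s ω))) n ω‖ₑ ∂μ)
      atTop (𝓝 0) := by
  have hκ : Measurable fun p => ∫ z, g z ∂(κ p) :=
    (StronglyMeasurable.integral_kernel hg.stronglyMeasurable).measurable
  have hκB : ∀ p, |∫ z, g z ∂(κ p)| ≤ B := fun p => by
    have hp : ∀ᵐ z ∂(κ p), ‖g z‖ ≤ B := ae_of_all _ hB
    simpa using norm_integral_le_of_norm_le_const hp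
  have hgi : ∀ s, Integrable (fun ω => g (ζ s ω)) μ := fun s =>
    Integrable.of_bound (hg.comp ((h.measurable_pair' s).snd)).aestronglyMeasurable B
      (ae_of_all _ fun ω => hB _)
  have hκi : ∀ s, Integrable (fun ω => ∫ z, g z ∂(κ (θ s ω))) μ := fun s =>
    Integrable.of_bound (hκ.comp (h.measurable_param' s)).aestronglyMeasurable B
      (ae_of_all _ fun ω => hκB _)
  refine tendsto_lintegral_enorm_cesaro_of_condExp_eq_zero (ℱ := ℱ) (B := B + B) (fun s => ?_)
    (fun s ω => (abs_sub _ _).trans (add_le_add (hB _) (hκB _))) fun s => ?_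
  · exact (hg.comp (h.measurable_obs s)).sub
      (hκ.comp (h.measurable_pair s).fst)
  · have hcond := h.condExp_ae_eq s (f := fun q => g q.2) (hg.comp measurable_snd) (hgi s)
    have hself := condExp_of_stronglyMeasurable (ℱ.le s)
      (hκ.comp (h.measurable_param s)).stronglyMeasurable (hκi s)
    filter_upwards [condExp_sub (hgi s) (hκi s) (ℱ s), hcond] with ω h1 h2
    exact h1.trans (sub_eq_zero.2 (h2.trans (congrFun hself ω).symm))

lemma lintegral_enorm_sub_integral_le (h : IsKernelDriven μ ℱ θ ζ κ) {ν : Measure Z}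
    (hν : ∀ p, κ p ≤ ν) {g : Z → ℝ} (hg : Measurable g) (s : ℕ) :
    ∫⁻ ω, ‖g (ζ s ω) - ∫ z, g z ∂(κ (θ s ω))‖ₑ ∂μ ≤ 2 * ∫⁻ z, ‖g z‖ₑ ∂ν := by
  have hκν : ∫⁻ ω, ∫⁻ z, ‖g z‖ₑ ∂(κ (θ s ω)) ∂μ ≤ ∫⁻ z, ‖g z‖ₑ ∂ν :=
    (lintegral_mono fun ω => lintegral_mono' (hν _) le_rfl).trans_eq (by simp)
  calc ∫⁻ ω, ‖g (ζ s ω) - ∫ z, g z ∂(κ (θ s ω))‖ₑ ∂μ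
      ≤ ∫⁻ ω, ‖g (ζ s ω)‖ₑ + ∫⁻ z, ‖g z‖ₑ ∂(κ (θ s ω)) ∂μ :=
        lintegral_mono fun ω => enorm_sub_le.trans
          (add_le_add_right (enorm_integral_le_lintegral_enorm _) _)
    _ = ∫⁻ ω, ∫⁻ z, ‖g z‖ₑ ∂(κ (θ s ω)) ∂μ + ∫⁻ ω, ∫⁻ z, ‖g z‖ₑ ∂(κ (θ s ω)) ∂μ := by
        rw [lintegral_add_left (f := fun ω => ‖g (ζ s ω)‖ₑ)
          (hg.comp (h.measurable_pair' s).snd).enorm,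
          h.lintegral_eq s (f := fun q => ‖g q.2‖ₑ) (hg.comp measurable_snd).enorm]
    _ ≤ 2 * ∫⁻ z, ‖g z‖ₑ ∂ν := by
        rw [two_mul]
        exact add_le_add hκν hκν

lemma tendsto_lintegral_enorm_cesaro_sub (h : IsKernelDriven μ ℱ θ ζ κ) {ν : Measure Z}
    (hν : ∀ p, κ p ≤ ν) {g : Z → ℝ} (hgm : Measurable g) (hg : Integrable g ν) :
    Tendsto (fun n => ∫⁻ ω, ‖cesaro (fun s ω => g (ζ s ω) - ∫ z, g z ∂(κ (θ s ω))) n ω‖ₑ ∂μ)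
      atTop (𝓝 0) := by
  have hm : ∀ {k : Z → ℝ}, Measurable k → ∀ s,
      Measurable fun ω => k (ζ s ω) - ∫ z, k z ∂(κ (θ s ω)) := fun hk s =>
    (hk.comp (h.measurable_pair' s).snd).sub
      ((StronglyMeasurable.integral_kernel hk.stronglyMeasurable).measurable.comp
        (h.measurable_param' s))
  refine tendsto_lintegral_enorm_cesaro_of_approx (hm hgm) fun ε hε => ?_
  obtain ⟨k, hk, hk1⟩ := (memLp_one_iff_integrable.2 hg).exists_simpleFunc_eLpNorm_sub_lt
    ENNReal.one_ne_top (ENNReal.coe_ne_zero.2 (half_pos hε).ne')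
  obtain ⟨B, hB⟩ := k.exists_forall_norm_le
  have hki : Integrable (⇑k) ν := memLp_one_iff_integrable.1 hk1
  refine ⟨_, hm k.measurable, fun s => ?_,
    h.tendsto_lintegral_enorm_cesaro_sub_of_bounded k.measurable hB⟩
  have hsplit : ∀ ω, (g (ζ s ω) - ∫ z, g z ∂(κ (θ s ω))) - (k (ζ s ω) - ∫ z, k z ∂(κ (θ s ω)))
      = (g - ⇑k) (ζ s ω) - ∫ z, (g - ⇑k) z ∂(κ (θ s ω)) := fun ω => by
    rw [integral_sub' (hg.mono_measure (hν _)) (hki.mono_measure (hν _)), Pi.sub_apply]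
    ring
  simp_rw [hsplit]
  refine (h.lintegral_enorm_sub_integral_le hν (g := g - ⇑k) (hgm.sub k.measurable) s).trans ?_
  rw [← eLpNorm_one_eq_lintegral_enorm]
  calc 2 * eLpNorm (g - ⇑k) 1 ν ≤ 2 * ((ε / 2 : NNReal) : ℝ≥0∞) := by gcongr
    _ = ε := by
      rw [ENNReal.coe_div two_ne_zero, ENNReal.coe_two]
      exact ENNReal.mul_div_cancel two_ne_zero ENNReal.ofNat_ne_top

variable [TopologicalSpace P] {θstar : P}

lemma tendsto_lintegral_enorm_cesaro_of_tendsto_zero (h : IsKernelDriven μ ℱ θ ζ κ)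
    (hθ : ∀ᵐ ω ∂μ, Tendsto (fun s => θ s ω) atTop (𝓝 θstar)) {r : P × Z → ℝ} (hr : Measurable r)
    (hbdd : ∀ p, ∫⁻ z, ‖r (p, z)‖ₑ ∂(κ p) ≤ 1)
    (hlim : Tendsto (fun p => ∫⁻ z, ‖r (p, z)‖ₑ ∂(κ p)) (𝓝 θstar) (𝓝 0)) :
    Tendsto (fun n => ∫⁻ ω, ‖cesaro (fun s ω => r (θ s ω, ζ s ω)) n ω‖ₑ ∂μ) atTop (𝓝 0) := by
  have hmean : Tendsto (fun s => ∫⁻ ω, ‖r (θ s ω, ζ s ω)‖ₑ ∂μ) atTop (𝓝 0) := by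
    simp_rw [fun s => h.lintegral_eq s hr.enorm]
    rw [← lintegral_zero (μ := μ)]
    exact tendsto_lintegral_of_dominated_convergence (fun _ => 1)
      (fun s => hr.enorm.lintegral_kernel_prod_right'.comp (h.measurable_param' s))
      (fun s => ae_of_all _ fun ω => hbdd _) (by simp) (hθ.mono fun ω hω => hlim.comp hω)
  have hfin : ∀ s, ∫⁻ ω, ‖r (θ s ω, ζ s ω)‖ₑ ∂μ ≠ ∞ := fun s => by
    rw [h.lintegral_eq s hr.enorm]
    exact ((lintegral_mono fun ω => hbdd _).trans_lt (by simp)).ne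
  exact tendsto_lintegral_enorm_cesaro (fun s => hr.comp (h.measurable_pair' s))
    (fun _ => ENNReal.toReal_nonneg) (fun s => (ENNReal.ofReal_toReal (hfin s)).ge)
    ((ENNReal.tendsto_toReal ENNReal.zero_ne_top).comp hmean)

lemma tendstoInMeasure_cesaro_of_tendsto_zero (h : IsKernelDriven μ ℱ θ ζ κ)
    (hθ : ∀ᵐ ω ∂μ, Tendsto (fun s => θ s ω) atTop (𝓝 θstar)) {r : P × Z → ℝ} (hr : Measurable r)
    (hlim : Tendsto (fun p => ∫⁻ z, ‖r (p, z)‖ₑ ∂(κ p)) (𝓝 θstar) (𝓝 0)) :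
    TendstoInMeasure μ (cesaro fun s ω => r (θ s ω, ζ s ω)) atTop fun _ => 0 := by
  set U : Set P := {p | ∫⁻ z, ‖r (p, z)‖ₑ ∂(κ p) ≤ 1}
  have hU : MeasurableSet (Prod.fst ⁻¹' U : Set (P × Z)) :=
    measurable_fst (hr.enorm.lintegral_kernel_prod_right' measurableSet_Iic)
  have hr₁ := hr.indicator hU
  have hr₂ := hr.indicator hU.compl
  have hle : ∀ p, ∫⁻ z, ‖(Prod.fst ⁻¹' U).indicator r (p, z)‖ₑ ∂(κ p) ≤
      ∫⁻ z, ‖r (p, z)‖ₑ ∂(κ p) := fun p => by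
    refine lintegral_mono fun z => ?_
    rw [enorm_indicator_eq_indicator_enorm]
    exact Set.indicator_le_self _ _ _
  have hbdd : ∀ p, ∫⁻ z, ‖(Prod.fst ⁻¹' U).indicator r (p, z)‖ₑ ∂(κ p) ≤ 1 := fun p => by
    by_cases hp : p ∈ U
    · exact (hle p).trans hp
    · simp [hp]
  have hmain := tendstoInMeasure_of_tendsto_lintegral_enorm
    (measurable_cesaro fun s => hr₁.comp (h.measurable_pair' s))
    (h.tendsto_lintegral_enorm_cesaro_of_tendsto_zero hθ hr₁ hbdd
      (tendsto_of_tendsto_of_tendsto_of_le_of_le tendsto_const_nhds hlim (fun _ => zero_le) hle))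
  have hrest : ∀ᵐ ω ∂μ, Tendsto (fun s => (Prod.fst ⁻¹' U)ᶜ.indicator r (θ s ω, ζ s ω))
      atTop (𝓝 0) := by
    filter_upwards [hθ] with ω hω
    refine tendsto_const_nhds.congr' ?_
    filter_upwards [hω.eventually (hlim.eventually (ge_mem_nhds one_pos))] with s hs
    have hmem : (θ s ω, ζ s ω) ∈ (Prod.fst ⁻¹' U : Set (P × Z)) := hs
    exact (Set.indicator_of_notMem (Set.notMem_compl_iff.2 hmem) r).symm
  have hadd := tendstoInMeasure_add hmain (tendstoInMeasure_cesaro_of_tendsto_ae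
    (fun s => hr₂.comp (h.measurable_pair' s)) hrest)
  simp only [← cesaro_add, add_zero] at hadd
  refine hadd.congr_left fun n => ae_of_all _ fun ω => ?_
  exact congrArg _ (Finset.sum_congr rfl fun s _ => Set.indicator_self_add_compl_apply _ r _)

theorem tendstoInMeasure_cesaro (h : IsKernelDriven μ ℱ θ ζ κ)
    (hθ : ∀ᵐ ω ∂μ, Tendsto (fun s => θ s ω) atTop (𝓝 θstar)) {ν : Measure Z}
    (hν : ∀ p, κ p ≤ ν) {f : P → Z → ℝ} (hf : Measurable fun q : P × Z => f q.1 q.2)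
    (hint : Integrable (f θstar) ν)
    (hlim : Tendsto (fun p => ∫⁻ z, ‖f p z - f θstar z‖ₑ ∂(κ p)) (𝓝 θstar) (𝓝 0))
    (hκ : Tendsto (fun p => ∫ z, f θstar z ∂(κ p)) (𝓝 θstar) (𝓝 (∫ z, f θstar z ∂(κ θstar)))) :
    TendstoInMeasure μ (cesaro fun s ω => f (θ s ω) (ζ s ω)) atTop
      fun _ => ∫ z, f θstar z ∂(κ θstar) := by
  have hfs : Measurable (f θstar) := hf.comp measurable_prodMk_left
  have hκm : Measurable fun p => ∫ z, f θstar z ∂(κ p) :=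
    (StronglyMeasurable.integral_kernel hfs.stronglyMeasurable).measurable
  have hmart := tendstoInMeasure_of_tendsto_lintegral_enorm
    (measurable_cesaro fun s => (hfs.comp (h.measurable_pair' s).snd).sub
      (hκm.comp (h.measurable_param' s)))
    (h.tendsto_lintegral_enorm_cesaro_sub hν hfs hint)
  have hmean := tendstoInMeasure_cesaro_of_tendsto_ae
    (fun s => hκm.comp (h.measurable_param' s)) (hθ.mono fun ω hω => hκ.comp hω)
  have herr := h.tendstoInMeasure_cesaro_of_tendsto_zero hθ
    (r := fun q => f q.1 q.2 - f θstar q.2) (hf.sub (hfs.comp measurable_snd)) hlim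
  have hadd := tendstoInMeasure_add (tendstoInMeasure_add hmart hmean) herr
  simp only [← cesaro_add, add_zero, zero_add] at hadd
  refine hadd.congr_left fun n => ae_of_all _ fun ω => ?_
  simp only [cesaro, Pi.sub_apply, Function.comp_apply, sub_add_cancel, add_sub_cancel]

end Average

end IsKernelDriven

end KernelDriven

section RobbinsSiegmund

variable {Ω : Type*} {m0 : MeasurableSpace Ω} {μ : Measure Ω} [IsProbabilityMeasure μ]
  {ℱ : Filtration ℕ m0}

lemma exists_ae_tendsto_of_supermartingale_of_nonneg {W : ℕ → Ω → ℝ}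
    (hW : Supermartingale W ℱ μ) (h0 : ∀ t ω, 0 ≤ W t ω) :
    ∀ᵐ ω ∂μ, ∃ c, Tendsto (fun t => W t ω) atTop (𝓝 c) := by
  have hbdd : ∀ t, eLpNorm ((-W) t) 1 μ ≤ (∫ ω, W 0 ω ∂μ).toNNReal := fun t => by
    rw [Pi.neg_apply, eLpNorm_neg, eLpNorm_one_eq_lintegral_enorm,
      ← ofReal_integral_norm_eq_lintegral_enorm (hW.integrable t)]
    refine ENNReal.ofReal_le_ofReal ?_
    simp only [Real.norm_eq_abs, abs_of_nonneg (h0 t _)]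
    simpa only [setIntegral_univ] using
      hW.setIntegral_le (zero_le (a := t)) (s := Set.univ) MeasurableSet.univ
  filter_upwards [hW.neg.exists_ae_tendsto_of_bdd hbdd] with ω ⟨c, hc⟩
  exact ⟨-c, by simpa only [Pi.neg_apply, neg_neg] using hc.neg⟩

lemma exists_prod_one_add_tendsto {a : ℕ → ℝ} (ha : ∀ t, 0 ≤ a t) (hs : Summable a) :
    ∃ c, (∀ t, ∏ s ∈ Finset.range t, (1 + a s) ≤ c) ∧
      Tendsto (fun t => ∏ s ∈ Finset.range t, (1 + a s)) atTop (𝓝 c) := by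
  have hmono : Monotone fun t => ∏ s ∈ Finset.range t, (1 + a s) :=
    monotone_nat_of_le_succ fun t => by
      rw [Finset.prod_range_succ]
      exact le_mul_of_one_le_right (Finset.prod_nonneg fun s _ => by linarith [ha s])
        (by linarith [ha t])
  have hbdd : BddAbove (Set.range fun t => ∏ s ∈ Finset.range t, (1 + a s)) := by
    refine ⟨Real.exp (∑' s, a s), ?_⟩
    rintro _ ⟨t, rfl⟩
    exact (Real.prod_one_add_le_exp_sum _ ha).trans
      (Real.exp_le_exp.2 (hs.sum_le_tsum _ fun s _ => ha s))
  have hlim := tendsto_atTop_ciSup hmono hbdd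
  exact ⟨_, hmono.ge_of_tendsto hlim, hlim⟩

variable {V U : ℕ → Ω → ℝ} {a : ℕ → ℝ}

lemma supermartingale_discounted (hV : StronglyAdapted ℱ V) (hU : StronglyAdapted ℱ U)
    (hVi : ∀ t, Integrable (V t) μ) (hUi : ∀ t, Integrable (U t) μ) (ha : ∀ t, 0 ≤ a t)
    (hstep : ∀ t, μ[V (t + 1) | ℱ t] ≤ᵐ[μ] fun ω => (1 + a t) * V t ω - U t ω) :
    Supermartingale (fun t ω => (∏ s ∈ Finset.range t, (1 + a s))⁻¹ * V t ω +
      ∑ s ∈ Finset.range t, (∏ r ∈ Finset.range (s + 1), (1 + a r))⁻¹ * U s ω) ℱ μ := by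
  set p : ℕ → ℝ := fun t => ∏ s ∈ Finset.range t, (1 + a s)
  have hp : ∀ t, 0 < p t := fun t => Finset.prod_pos fun s _ => by linarith [ha s]
  have hsum : ∀ t n, t ≤ n + 1 → StronglyMeasurable[ℱ n]
      fun ω => ∑ s ∈ Finset.range t, (p (s + 1))⁻¹ * U s ω := fun t n htn =>
    Finset.stronglyMeasurable_fun_sum _ fun s hs => (((hU s).mono (ℱ.mono
      (Nat.lt_succ_iff.1 ((Finset.mem_range.1 hs).trans_le htn)))).const_mul _)
  have hsumi : ∀ t, Integrable (fun ω => ∑ s ∈ Finset.range t, (p (s + 1))⁻¹ * U s ω) μ :=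
    fun t => integrable_finsetSum _ fun s _ => (hUi s).const_mul _
  refine supermartingale_nat (fun t => ((hV t).const_mul _).add (hsum t t t.le_succ))
    (fun t => ((hVi t).const_mul _).add (hsumi t)) fun t => ?_
  filter_upwards [condExp_add ((hVi (t + 1)).const_mul (p (t + 1))⁻¹) (hsumi (t + 1)) (ℱ t),
    condExp_smul (p (t + 1))⁻¹ (V (t + 1)) (ℱ t), hstep t] with ω hadd hsmul hω
  have hself := congrFun (condExp_of_stronglyMeasurable (ℱ.le t) (hsum (t + 1) t le_rfl)
    (hsumi (t + 1))) ω
  have hsucc : p (t + 1) = p t * (1 + a t) := Finset.prod_range_succ _ _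
  have hat : 0 < 1 + a t := by linarith [ha t]
  calc _ = (p (t + 1))⁻¹ * (μ[V (t + 1) | ℱ t]) ω +
        ∑ s ∈ Finset.range (t + 1), (p (s + 1))⁻¹ * U s ω := by
        refine hadd.trans ?_
        rw [Pi.add_apply, hself]
        exact congrArg (· + _) hsmul
    _ ≤ (p (t + 1))⁻¹ * ((1 + a t) * V t ω - U t ω) +
        ∑ s ∈ Finset.range (t + 1), (p (s + 1))⁻¹ * U s ω := by
        gcongr
        exact inv_nonneg.2 (hp _).le
    _ = (p t)⁻¹ * V t ω + ∑ s ∈ Finset.range t, (p (s + 1))⁻¹ * U s ω := by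
        rw [Finset.sum_range_succ, hsucc]
        have := (hp t).ne'
        field_simp
        ring

/-- The **Robbins–Siegmund theorem**, without additive noise. -/
theorem robbins_siegmund (hV : StronglyAdapted ℱ V) (hU : StronglyAdapted ℱ U)
    (hVi : ∀ t, Integrable (V t) μ)
    (hV0 : ∀ t ω, 0 ≤ V t ω) (hU0 : ∀ t ω, 0 ≤ U t ω) (ha : ∀ t, 0 ≤ a t) (has : Summable a)
    (hstep : ∀ t, μ[V (t + 1) | ℱ t] ≤ᵐ[μ] fun ω => (1 + a t) * V t ω - U t ω) :
    ∀ᵐ ω ∂μ, (∃ c, Tendsto (fun t => V t ω) atTop (𝓝 c)) ∧ Summable fun t => U t ω := by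
  have hUi : ∀ t, Integrable (U t) μ := fun t => by
    refine (((hVi t).const_mul (1 + a t)).sub (integrable_condExp (m := ℱ t)
      (f := V (t + 1)))).mono' ((hU t).mono (ℱ.le t)).aestronglyMeasurable ?_
    filter_upwards [hstep t] with ω hω
    rw [Real.norm_of_nonneg (hU0 t ω), Pi.sub_apply]
    linarith
  obtain ⟨c, hpc, hplim⟩ := exists_prod_one_add_tendsto ha has
  set p : ℕ → ℝ := fun t => ∏ s ∈ Finset.range t, (1 + a s)
  have hp : ∀ t, 0 < p t := fun t => Finset.prod_pos fun s _ => by linarith [ha s]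
  have hterm : ∀ s ω, 0 ≤ (p (s + 1))⁻¹ * U s ω := fun s ω =>
    mul_nonneg (inv_nonneg.2 (hp _).le) (hU0 s ω)
  have hconv := exists_ae_tendsto_of_supermartingale_of_nonneg
    (supermartingale_discounted hV hU hVi hUi ha hstep) fun t ω =>
      add_nonneg (mul_nonneg (inv_nonneg.2 (hp t).le) (hV0 t ω))
        (Finset.sum_nonneg fun s _ => hterm s ω)
  filter_upwards [hconv] with ω ⟨w, hw⟩
  obtain ⟨B, hB⟩ := hw.bddAbove_range
  have hsum : Summable fun s => (p (s + 1))⁻¹ * U s ω :=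
    summable_of_sum_range_le (c := B) (fun s => hterm s ω) fun t =>
      le_trans (le_add_of_nonneg_left (mul_nonneg (inv_nonneg.2 (hp t).le) (hV0 t ω)))
        (hB ⟨t, rfl⟩)
  refine ⟨⟨c * (w - ∑' s, (p (s + 1))⁻¹ * U s ω), ?_⟩, ?_⟩
  · refine (hplim.mul (hw.sub hsum.hasSum.tendsto_sum_nat)).congr fun t => ?_
    rw [add_sub_cancel_right, mul_inv_cancel_left₀ (hp t).ne']
  · refine (hsum.mul_left c).of_nonneg_of_le (fun s => hU0 s ω) fun s => ?_
    rw [← mul_assoc]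
    refine le_mul_of_one_le_left (hU0 s ω) ?_
    rw [← div_eq_mul_inv, one_le_div (hp _)]
    exact hpc _

lemma eq_zero_of_tendsto_of_summable_mul {γ v b : ℕ → ℝ} {L : ℝ} (hγ : ∀ t, 0 ≤ γ t)
    (hγs : ¬ Summable γ) (hv0 : ∀ t, 0 ≤ v t) (hv : Tendsto v atTop (𝓝 L))
    (hb : ∀ r R, 0 < r → ∃ c, 0 < c ∧ ∀ t, r ≤ v t → v t ≤ R → c ≤ b t)
    (hs : Summable fun t => γ t * b t) : L = 0 := by
  by_contra hne
  have hpos : 0 < L := lt_of_le_of_ne (ge_of_tendsto' hv hv0) (Ne.symm hne)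
  obtain ⟨c, hc, hcb⟩ := hb (L / 2) (L + 1) (half_pos hpos)
  refine hγs (Summable.of_norm_bounded_eventually_nat (hs.mul_left c⁻¹) ?_)
  filter_upwards [hv.eventually (Ioo_mem_nhds (half_lt_self hpos) (lt_add_one L))] with t ht
  rw [Real.norm_of_nonneg (hγ t), mul_left_comm]
  refine le_mul_of_one_le_right (hγ t) ?_
  rw [← div_eq_inv_mul, one_le_div hc]
  exact hcb t ht.1.le ht.2.le

end RobbinsSiegmund

section SecondMoment

variable {Z E : Type*} [MeasurableSpace Z] [NormedAddCommGroup E] {ρ : Measure Z}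

lemma memLp_two_of_lintegral_sq_le {v : Z → E} (hv : AEStronglyMeasurable v ρ) {c : ℝ}
    (hc : ∫⁻ z, ‖v z‖ₑ ^ 2 ∂ρ ≤ ENNReal.ofReal c) : MemLp v 2 ρ := by
  refine ⟨hv, ?_⟩
  rw [eLpNorm_lt_top_iff_lintegral_rpow_enorm_lt_top two_ne_zero ENNReal.ofNat_ne_top]
  simpa using hc.trans_lt ENNReal.ofReal_lt_top

lemma integral_norm_sq_le_of_lintegral_sq_le {v : Z → E} (hv : AEStronglyMeasurable v ρ) {c : ℝ}
    (hc0 : 0 ≤ c) (hc : ∫⁻ z, ‖v z‖ₑ ^ 2 ∂ρ ≤ ENNReal.ofReal c) : ∫ z, ‖v z‖ ^ 2 ∂ρ ≤ c := by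
  rw [integral_eq_lintegral_of_nonneg_ae (ae_of_all _ fun z => sq_nonneg _) (hv.norm.pow 2)]
  simp_rw [ENNReal.ofReal_pow (norm_nonneg _), ofReal_norm]
  exact ENNReal.toReal_le_of_le_ofReal hc0 hc

lemma integral_norm_sub_smul_sq [InnerProductSpace ℝ E] [CompleteSpace E]
    [IsProbabilityMeasure ρ] {v : Z → E} (hv : MemLp v 2 ρ) (u : E) (c : ℝ) :
    ∫ z, ‖u - c • v z‖ ^ 2 ∂ρ =
      ‖u‖ ^ 2 - 2 * c * inner ℝ (∫ z, v z ∂ρ) u + c ^ 2 * ∫ z, ‖v z‖ ^ 2 ∂ρ := by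
  have hi : Integrable v ρ := hv.integrable one_le_two
  have hsq : Integrable (fun z => ‖v z‖ ^ 2) ρ := hv.integrable_norm_pow two_ne_zero
  have hexp : ∀ z, ‖u - c • v z‖ ^ 2 =
      ‖u‖ ^ 2 - 2 * c * inner ℝ u (v z) + c ^ 2 * ‖v z‖ ^ 2 := fun z => by
    rw [norm_sub_sq_real, inner_smul_right, norm_smul, mul_pow, Real.norm_eq_abs, sq_abs]
    ring
  have hlin : Integrable (fun z => 2 * c * inner ℝ u (v z)) ρ := (hi.const_inner u).const_mul _
  have hdiff : Integrable (fun z => ‖u‖ ^ 2 - 2 * c * inner ℝ u (v z)) ρ :=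
    (integrable_const _).sub hlin
  simp_rw [hexp]
  rw [integral_add hdiff (hsq.const_mul _), integral_sub (integrable_const _) hlin,
    integral_const_mul, integral_const_mul, integral_inner hi, integral_const, probReal_univ,
    one_smul, real_inner_comm]

end SecondMoment

section RobbinsMonro

lemma inner_nonneg_of_forall_annulus {E : Type*} [NormedAddCommGroup E] [InnerProductSpace ℝ E]
    {g : E → E} {p₀ : E} (h : ∀ r R : ℝ, 0 < r → r ≤ R → ∃ c : ℝ, 0 < c ∧ ∀ p, r ≤ ‖p - p₀‖ →
      ‖p - p₀‖ ≤ R → c ≤ inner ℝ (g p) (p - p₀)) (p : E) : 0 ≤ inner ℝ (g p) (p - p₀) := by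
  rcases eq_or_ne p p₀ with rfl | hne
  · simp
  · obtain ⟨c, hc, hcp⟩ := h _ _ (norm_pos_iff.2 (sub_ne_zero.2 hne)) le_rfl
    exact hc.le.trans (hcp p le_rfl le_rfl)

namespace IsKernelDriven

variable {E : Type*} [NormedAddCommGroup E] [MeasurableSpace E] [BorelSpace E]
  [SecondCountableTopology E] {Ω Z : Type*} {m0 : MeasurableSpace Ω} [MeasurableSpace Z]
  {μ : Measure Ω} [IsProbabilityMeasure μ] {ℱ : Filtration ℕ m0} {θ : ℕ → Ω → E} {ζ : ℕ → Ω → Z}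
  {κ : Kernel E Z} [IsMarkovKernel κ] {v : E → Z → E} {γ : ℕ → ℝ} {θstar : E} {C : ℝ}

lemma memLp_field (h : IsKernelDriven μ ℱ θ ζ κ) (hv : Measurable fun q : E × Z => v q.1 q.2)
    (hv2 : ∀ p, ∫⁻ z, ‖v p z‖ₑ ^ 2 ∂(κ p) ≤ ENNReal.ofReal (C * (1 + ‖p - θstar‖ ^ 2)))
    {t : ℕ} (hθ : MemLp (θ t) 2 μ) : MemLp (fun ω => v (θ t ω) (ζ t ω)) 2 μ := by
  have hi : Integrable (fun ω => C * (1 + ‖θ t ω - θstar‖ ^ 2)) μ :=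
    ((integrable_const _).add
      ((hθ.sub (memLp_const θstar)).integrable_norm_pow two_ne_zero)).const_mul C
  refine ⟨(hv.comp (h.measurable_pair' t)).aestronglyMeasurable, ?_⟩
  rw [eLpNorm_lt_top_iff_lintegral_rpow_enorm_lt_top two_ne_zero ENNReal.ofNat_ne_top]
  simp only [ENNReal.toReal_ofNat, ENNReal.rpow_ofNat]
  rw [h.lintegral_eq t (f := fun q => ‖v q.1 q.2‖ₑ ^ 2) (hv.enorm.pow_const 2)]
  exact (lintegral_mono fun ω => hv2 _).trans_lt hi.lintegral_lt_top

variable [InnerProductSpace ℝ E]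

lemma memLp_iterate (h : IsKernelDriven μ ℱ θ ζ κ) (hv : Measurable fun q : E × Z => v q.1 q.2)
    (hv2 : ∀ p, ∫⁻ z, ‖v p z‖ₑ ^ 2 ∂(κ p) ≤ ENNReal.ofReal (C * (1 + ‖p - θstar‖ ^ 2)))
    (hstep : ∀ t ω, θ (t + 1) ω = θ t ω - γ t • v (θ t ω) (ζ t ω)) (h0 : MemLp (θ 0) 2 μ)
    (t : ℕ) : MemLp (θ t) 2 μ := by
  induction t with
  | zero => exact h0
  | succ t ih =>
    rw [funext (hstep t)]
    exact ih.sub ((h.memLp_field hv hv2 ih).const_smul (γ t))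

variable [CompleteSpace E]

lemma condExp_one_add_norm_sub_sq_le (h : IsKernelDriven μ ℱ θ ζ κ)
    (hv : Measurable fun q : E × Z => v q.1 q.2) (hC : 0 ≤ C)
    (hv2 : ∀ p, ∫⁻ z, ‖v p z‖ₑ ^ 2 ∂(κ p) ≤ ENNReal.ofReal (C * (1 + ‖p - θstar‖ ^ 2)))
    (hstep : ∀ t ω, θ (t + 1) ω = θ t ω - γ t • v (θ t ω) (ζ t ω)) {t : ℕ}
    (hi : Integrable (fun ω => 1 + ‖θ (t + 1) ω - θstar‖ ^ 2) μ) :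
    μ[fun ω => 1 + ‖θ (t + 1) ω - θstar‖ ^ 2 | ℱ t] ≤ᵐ[μ] fun ω =>
      (1 + C * γ t ^ 2) * (1 + ‖θ t ω - θstar‖ ^ 2) -
        2 * (γ t * inner ℝ (∫ z, v (θ t ω) z ∂(κ (θ t ω))) (θ t ω - θstar)) := by
  have hstep' : ∀ ω, θ (t + 1) ω - θstar = (θ t ω - θstar) - γ t • v (θ t ω) (ζ t ω) := fun ω => by
    rw [hstep, sub_right_comm]
  simp only [hstep'] at hi ⊢
  have hf : Measurable fun q : E × Z => 1 + ‖(q.1 - θstar) - γ t • v q.1 q.2‖ ^ 2 := by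
    fun_prop
  filter_upwards [h.condExp_ae_eq t hf hi] with ω hω
  rw [hω]
  have hvm : AEStronglyMeasurable (v (θ t ω)) (κ (θ t ω)) :=
    (hv.comp measurable_prodMk_left).aestronglyMeasurable
  have hv2' : MemLp (v (θ t ω)) 2 (κ (θ t ω)) := memLp_two_of_lintegral_sq_le hvm (hv2 _)
  have hdiff : Integrable (fun z => ‖(θ t ω - θstar) - γ t • v (θ t ω) z‖ ^ 2) (κ (θ t ω)) :=
    ((memLp_const _).sub (hv2'.const_smul (γ t))).integrable_norm_pow two_ne_zero
  rw [integral_add (integrable_const _) hdiff, integral_norm_sub_smul_sq hv2', integral_const,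
    probReal_univ, one_smul]
  have hbound := mul_le_mul_of_nonneg_left (integral_norm_sq_le_of_lintegral_sq_le hvm
    (by positivity) (hv2 (θ t ω))) (sq_nonneg (γ t))
  linarith

/-- The **Robbins–Monro theorem**. -/
theorem ae_tendsto_of_inner_pos (h : IsKernelDriven μ ℱ θ ζ κ)
    (hv : Measurable fun q : E × Z => v q.1 q.2) (hC : 0 ≤ C)
    (hv2 : ∀ p, ∫⁻ z, ‖v p z‖ₑ ^ 2 ∂(κ p) ≤ ENNReal.ofReal (C * (1 + ‖p - θstar‖ ^ 2)))
    (hstep : ∀ t ω, θ (t + 1) ω = θ t ω - γ t • v (θ t ω) (ζ t ω)) (h0 : MemLp (θ 0) 2 μ)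
    (hγ : ∀ t, 0 ≤ γ t) (hγ_sum : ¬ Summable γ) (hγ_sq : Summable fun t => γ t ^ 2)
    (hpos : ∀ r R : ℝ, 0 < r → r ≤ R → ∃ c : ℝ, 0 < c ∧ ∀ p, r ≤ ‖p - θstar‖ →
      ‖p - θstar‖ ≤ R → c ≤ inner ℝ (∫ z, v p z ∂(κ p)) (p - θstar)) :
    ∀ᵐ ω ∂μ, Tendsto (fun t => θ t ω) atTop (𝓝 θstar) := by
  set b : E → ℝ := fun p => inner ℝ (∫ z, v p z ∂(κ p)) (p - θstar)
  have hb : Measurable b :=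
    (StronglyMeasurable.integral_kernel_prod_right' hv.stronglyMeasurable).measurable.inner
      (measurable_id.sub_const θstar)
  have hdist : Measurable fun p : E => 1 + ‖p - θstar‖ ^ 2 := by fun_prop
  have hb0 : ∀ p, 0 ≤ b p := inner_nonneg_of_forall_annulus hpos
  have hVi : ∀ t, Integrable (fun ω => 1 + ‖θ t ω - θstar‖ ^ 2) μ := fun t =>
    (integrable_const _).add (((h.memLp_iterate hv hv2 hstep h0 t).sub
      (memLp_const θstar)).integrable_norm_pow two_ne_zero)
  have hrs := robbins_siegmund (a := fun t => C * γ t ^ 2)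
    (V := fun t ω => 1 + ‖θ t ω - θstar‖ ^ 2) (U := fun t ω => 2 * (γ t * b (θ t ω)))
    (fun t => (hdist.comp (h.measurable_param t)).stronglyMeasurable)
    (fun t => (((hb.comp (h.measurable_param t)).const_mul (γ t)).const_mul 2).stronglyMeasurable)
    hVi (fun t ω => by positivity) (fun t ω => by have := hb0 (θ t ω); have := hγ t; positivity)
    (fun t => mul_nonneg hC (sq_nonneg _)) (hγ_sq.mul_left C)
    fun t => h.condExp_one_add_norm_sub_sq_le hv hC hv2 hstep (hVi (t + 1))
  filter_upwards [hrs] with ω ⟨⟨c, hc⟩, hU⟩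
  have hnorm : Tendsto (fun t => ‖θ t ω - θstar‖) atTop (𝓝 √(c - 1)) := by
    simpa only [add_sub_cancel_left, Real.sqrt_sq (norm_nonneg _)] using (hc.sub_const 1).sqrt
  have hzero : √(c - 1) = 0 := by
    refine eq_zero_of_tendsto_of_summable_mul hγ hγ_sum (fun t => norm_nonneg _) hnorm
      (b := fun t => b (θ t ω)) (fun r R hr => ?_) ((summable_mul_left_iff two_ne_zero).1 hU)
    obtain ⟨c, hc, hcb⟩ := hpos r (max r R) hr (le_max_left _ _)
    exact ⟨c, hc, fun t h1 h2 => hcb _ h1 (h2.trans (le_max_right _ _))⟩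
  rw [hzero] at hnorm
  exact tendsto_iff_norm_sub_tendsto_zero.2 hnorm

end IsKernelDriven

end RobbinsMonro

section Derivatives

variable {d : ℕ} {Z : Type*} [MeasurableSpace Z]

lemma gradient_apply (f : Param d → ℝ) (θ : Param d) (i : Fin d) :
    gradient f θ i = fderiv ℝ f θ (EuclideanSpace.single i 1) := by
  rw [← InnerProductSpace.toDual_symm_apply (𝕜 := ℝ), ← gradient,
    EuclideanSpace.inner_single_right]
  simp

lemma measurable_fderiv_apply_of_differentiable {E : Type*} [NormedAddCommGroup E]
    [NormedSpace ℝ E] [MeasurableSpace E] [BorelSpace E] [SecondCountableTopology E]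
    {F : E → Z → ℝ} (hF : Measurable fun p : E × Z => F p.1 p.2)
    (hd : ∀ z, Differentiable ℝ fun θ => F θ z) (v : E) :
    Measurable fun p : E × Z => fderiv ℝ (fun θ => F θ p.2) p.1 v := by
  refine measurable_of_tendsto_metrizable (f := fun (n : ℕ) (p : E × Z) =>
    (n : ℝ) • (F (p.1 + (n : ℝ)⁻¹ • v) p.2 - F p.1 p.2)) (fun n => ?_) ?_
  · exact ((hF.comp (by fun_prop : Measurable fun p : E × Z =>
      (p.1 + (n : ℝ)⁻¹ • v, p.2))).sub hF).const_smul (n : ℝ)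
  · rw [tendsto_pi_nhds]
    exact fun p =>
      ((hd p.2 p.1).hasFDerivAt.lim_real v).comp tendsto_natCast_atTop_atTop

lemma measurable_gradient_of_differentiable {F : Param d → Z → ℝ}
    (hF : Measurable fun p : Param d × Z => F p.1 p.2)
    (hd : ∀ z, Differentiable ℝ fun θ => F θ z) :
    Measurable fun p : Param d × Z => gradient (fun θ => F θ p.2) p.1 := by
  refine (WithLp.measurable_toLp 2 (Fin d → ℝ)).comp
    (measurable_pi_iff.2 fun i => ?_ : Measurable fun p : Param d × Z =>
      fun i => gradient (fun θ => F θ p.2) p.1 i)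
  simp only [gradient_apply]
  exact measurable_fderiv_apply_of_differentiable hF hd _

lemma hessian_apply {f : Param d → ℝ} {θ : Param d} (hf : DifferentiableAt ℝ (gradient f) θ)
    (i j : Fin d) :
    hessian f θ i j = fderiv ℝ (fun ϑ => gradient f ϑ i) θ (EuclideanSpace.single j 1) :=
  congrArg (fun L : Param d →L[ℝ] ℝ => L (EuclideanSpace.single j 1))
    ((EuclideanSpace.proj i : Param d →L[ℝ] ℝ).hasFDerivAt.comp θ hf.hasFDerivAt).fderiv.symm

lemma measurable_hessian_apply_of_differentiable {F : Param d → Z → ℝ}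
    (hF : Measurable fun p : Param d × Z => F p.1 p.2)
    (hd : ∀ z, Differentiable ℝ fun θ => F θ z)
    (hd' : ∀ z, Differentiable ℝ (gradient fun θ => F θ z)) (i j : Fin d) :
    Measurable fun p : Param d × Z => hessian (fun θ => F θ p.2) p.1 i j := by
  simp only [hessian_apply (hd' _ _)]
  refine measurable_fderiv_apply_of_differentiable
    (F := fun ϑ z => gradient (fun θ => F θ z) ϑ i) ?_ (fun z => ?_) _
  · have := measurable_gradient_of_differentiable hF hd
    fun_prop
  · exact (EuclideanSpace.proj i : Param d →L[ℝ] ℝ).differentiable.comp (hd' z)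

end Derivatives

section DifferentiationUnderIntegral

variable {Z : Type*} [MeasurableSpace Z] {ν : Measure Z}

lemma lintegral_mul_sq_le {f g : Z → ℝ≥0∞} (hf : AEMeasurable f ν) (hg : AEMeasurable g ν) :
    (∫⁻ z, f z * g z ∂ν) ^ 2 ≤ (∫⁻ z, f z ^ 2 ∂ν) * ∫⁻ z, g z ^ 2 ∂ν := by
  have h := ENNReal.lintegral_mul_le_Lp_mul_Lq ν Real.HolderConjugate.two_two hf hg
  simp only [Pi.mul_apply, ENNReal.rpow_two] at h
  have hsq (x : ℝ≥0∞) : (x ^ (1 / 2 : ℝ)) ^ 2 = x := by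
    rw [← ENNReal.rpow_two, ← ENNReal.rpow_mul]
    norm_num
  calc (∫⁻ z, f z * g z ∂ν) ^ 2
      ≤ ((∫⁻ z, f z ^ 2 ∂ν) ^ (1 / 2 : ℝ) * (∫⁻ z, g z ^ 2 ∂ν) ^ (1 / 2 : ℝ)) ^ 2 := by gcongr
    _ = _ := by rw [mul_pow, hsq, hsq]

lemma lintegral_sq_le_mul_measure_univ {f : Z → ℝ≥0∞} (hf : AEMeasurable f ν) :
    (∫⁻ z, f z ∂ν) ^ 2 ≤ (∫⁻ z, f z ^ 2 ∂ν) * ν Set.univ := by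
  simpa using lintegral_mul_sq_le hf (aemeasurable_const (b := 1))

lemma unifIntegrable_one_of_lintegral_sq_le {ι : Type*} {f : ι → Z → ℝ}
    (hf : ∀ i, AEStronglyMeasurable (f i) ν) {C : ℝ} (hC : 0 ≤ C)
    (h : ∀ i, ∫⁻ z, ‖f i z‖ₑ ^ 2 ∂ν ≤ ENNReal.ofReal C) : UnifIntegrable f 1 ν := by
  intro ε hε
  refine ⟨ε ^ 2 / (C + 1), by positivity, fun i s hs hνs => ?_⟩
  rw [eLpNorm_one_eq_lintegral_enorm]
  simp_rw [enorm_indicator_eq_indicator_enorm]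
  rw [lintegral_indicator hs, ← ENNReal.pow_le_pow_left_iff two_ne_zero,
    ← ENNReal.ofReal_pow hε.le]
  calc (∫⁻ z in s, ‖f i z‖ₑ ∂ν) ^ 2
      ≤ (∫⁻ z in s, ‖f i z‖ₑ ^ 2 ∂ν) * ν.restrict s Set.univ :=
        lintegral_sq_le_mul_measure_univ (hf i).enorm.restrict
    _ ≤ ENNReal.ofReal C * ENNReal.ofReal (ε ^ 2 / (C + 1)) := by
        rw [Measure.restrict_apply_univ]
        gcongr
        exact (setLIntegral_le_lintegral _ _).trans (h i)
    _ ≤ ENNReal.ofReal (ε ^ 2) := by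
        rw [← ENNReal.ofReal_mul hC]
        refine ENNReal.ofReal_le_ofReal ?_
        rw [← mul_div_assoc, div_le_iff₀ (by positivity)]
        nlinarith [sq_nonneg ε]

lemma enorm_sub_sq_le_lintegral_deriv {g g' : ℝ → ℝ} (hg : ∀ s, HasDerivAt g (g' s) s)
    (hm : Measurable g') {h : ℝ} (hh : 0 ≤ h) :
    ‖g h - g 0‖ₑ ^ 2 ≤ ENNReal.ofReal h * ∫⁻ s in Set.Ioc 0 h, ‖g' s‖ₑ ^ 2 := by
  have hftc : ‖g h - g 0‖ₑ ≤ ∫⁻ s in Set.Ioc 0 h, ‖g' s‖ₑ := by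
    by_cases htop : ∫⁻ s in Set.Ioc 0 h, ‖g' s‖ₑ = ∞
    · simp [htop]
    have hint : IntervalIntegrable g' volume 0 h := by
      rw [intervalIntegrable_iff_integrableOn_Ioc_of_le hh]
      exact ⟨hm.aestronglyMeasurable, lt_top_iff_ne_top.2 htop⟩
    rw [← intervalIntegral.integral_eq_sub_of_hasDerivAt (fun s _ => hg s) hint,
      intervalIntegral.integral_of_le hh]
    exact enorm_integral_le_lintegral_enorm _
  calc ‖g h - g 0‖ₑ ^ 2
      ≤ (∫⁻ s in Set.Ioc 0 h, ‖g' s‖ₑ) ^ 2 := by gcongr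
    _ ≤ (∫⁻ s in Set.Ioc 0 h, ‖g' s‖ₑ ^ 2) * volume.restrict (Set.Ioc 0 h) Set.univ :=
        lintegral_sq_le_mul_measure_univ hm.enorm.aemeasurable
    _ = _ := by rw [Measure.restrict_apply_univ, Real.volume_Ioc, sub_zero, mul_comm]

variable {g g' : ℝ → Z → ℝ}

lemma lintegral_enorm_diffQuot_sq_le [SFinite ν]
    (hg : ∀ z s, HasDerivAt (fun s => g s z) (g' s z) s)
    (hm' : Measurable fun p : ℝ × Z => g' p.1 p.2) {h : ℝ} (hh : 0 < h) {C : ℝ≥0∞}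
    (hbound : ∀ s ∈ Set.Ioc 0 h, ∫⁻ z, ‖g' s z‖ₑ ^ 2 ∂ν ≤ C) :
    ∫⁻ z, ‖h⁻¹ * (g h z - g 0 z)‖ₑ ^ 2 ∂ν ≤ C := by
  have hcancel : ENNReal.ofReal h⁻¹ * ENNReal.ofReal h = 1 := by
    rw [← ENNReal.ofReal_mul (inv_nonneg.2 hh.le), inv_mul_cancel₀ hh.ne', ENNReal.ofReal_one]
  have hpt (z : Z) : ‖h⁻¹ * (g h z - g 0 z)‖ₑ ^ 2 ≤
      ENNReal.ofReal h⁻¹ * ∫⁻ s in Set.Ioc 0 h, ‖g' s z‖ₑ ^ 2 :=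
    calc ‖h⁻¹ * (g h z - g 0 z)‖ₑ ^ 2
        = ENNReal.ofReal h⁻¹ ^ 2 * ‖g h z - g 0 z‖ₑ ^ 2 := by
          rw [enorm_mul, mul_pow, Real.enorm_of_nonneg (inv_nonneg.2 hh.le)]
      _ ≤ ENNReal.ofReal h⁻¹ ^ 2 *
          (ENNReal.ofReal h * ∫⁻ s in Set.Ioc 0 h, ‖g' s z‖ₑ ^ 2) := by
          gcongr
          exact enorm_sub_sq_le_lintegral_deriv (hg z) (hm'.comp measurable_prodMk_right) hh.le
      _ = _ := by rw [sq, mul_assoc, ← mul_assoc _ (ENNReal.ofReal h), hcancel, one_mul]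
  calc ∫⁻ z, ‖h⁻¹ * (g h z - g 0 z)‖ₑ ^ 2 ∂ν
      ≤ ∫⁻ z, (ENNReal.ofReal h⁻¹ * ∫⁻ s in Set.Ioc 0 h, ‖g' s z‖ₑ ^ 2) ∂ν :=
        lintegral_mono hpt
    _ = ENNReal.ofReal h⁻¹ * ∫⁻ s in Set.Ioc 0 h, (∫⁻ z, ‖g' s z‖ₑ ^ 2 ∂ν) := by
        rw [lintegral_const_mul' _ _ ENNReal.ofReal_ne_top, lintegral_lintegral_swap]
        exact ((hm'.comp measurable_swap).enorm.pow_const 2).aemeasurable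
    _ ≤ ENNReal.ofReal h⁻¹ * ∫⁻ _ in Set.Ioc 0 h, C := by
        gcongr 1
        exact setLIntegral_mono measurable_const hbound
    _ = C := by
        rw [setLIntegral_const, Real.volume_Ioc, sub_zero, mul_comm C, ← mul_assoc, hcancel,
          one_mul]

theorem eq_integral_of_hasDerivAt_of_lintegral_sq_le [IsFiniteMeasure ν]
    (hm : Measurable fun p : ℝ × Z => g p.1 p.2)
    (hg : ∀ z s, HasDerivAt (fun s => g s z) (g' s z) s) {C : ℝ} (hC : 0 ≤ C)
    (hbound : ∀ s ∈ Set.Icc (0 : ℝ) 1, ∫⁻ z, ‖g' s z‖ₑ ^ 2 ∂ν ≤ ENNReal.ofReal C)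
    (hint : ∀ s, Integrable (g s) ν) {c : ℝ} (hc : HasDerivAt (fun s => ∫ z, g s z ∂ν) c 0) :
    c = ∫ z, g' 0 z ∂ν := by
  have hm' : Measurable fun p : ℝ × Z => g' p.1 p.2 := by
    simpa only [← fun z s => (hg z s).deriv, fderiv_apply_one_eq_deriv] using
      measurable_fderiv_apply_of_differentiable hm (fun z s => (hg z s).differentiableAt) 1
  have hlim {f : ℝ → ℝ} {f' : ℝ} (hf : HasDerivAt f f' 0) :
      Tendsto (fun n : ℕ => ((n : ℝ) + 1)⁻¹⁻¹ * (f (((n : ℝ) + 1)⁻¹) - f 0)) atTop (𝓝 f') := by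
    simpa [Function.comp_def] using (hf.hasFDerivAt.lim_real 1).comp
      (tendsto_atTop_add_const_right _ (1 : ℝ) tendsto_natCast_atTop_atTop)
  let D (n : ℕ) (z : Z) : ℝ := ((n : ℝ) + 1)⁻¹⁻¹ * (g (((n : ℝ) + 1)⁻¹) z - g 0 z)
  have hDint (n : ℕ) : Integrable (D n) ν := ((hint _).sub (hint _)).const_mul _
  have hDbound (n : ℕ) : ∫⁻ z, ‖D n z‖ₑ ^ 2 ∂ν ≤ ENNReal.ofReal C :=
    lintegral_enorm_diffQuot_sq_le hg hm' (by positivity) fun s hs =>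
      hbound s ⟨hs.1.le, hs.2.trans (inv_le_one_of_one_le₀ (by simp))⟩
  have hg0 : MemLp (g' 0) 1 ν :=
    (memLp_two_of_lintegral_sq_le (hm'.comp measurable_prodMk_left).aestronglyMeasurable
      (hbound 0 (by simp))).mono_exponent one_le_two
  have hconv : Tendsto (fun n => eLpNorm (D n - g' 0) 1 ν) atTop (𝓝 0) :=
    tendsto_Lp_finite_of_tendsto_ae le_rfl ENNReal.one_ne_top
      (fun n => (hDint n).aestronglyMeasurable) hg0
      (unifIntegrable_one_of_lintegral_sq_le (fun n => (hDint n).aestronglyMeasurable) hC hDbound)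
      (ae_of_all _ fun z => hlim (hg z 0))
  refine tendsto_nhds_unique (hlim hc) ((tendsto_integral_of_L1' (g' 0) hg0.1
    (Eventually.of_forall hDint) hconv).congr fun n => ?_)
  rw [integral_const_mul, integral_sub (hint _) (hint _)]

end DifferentiationUnderIntegral

section SquareMean

lemma add_sq_le_two_mul (a b : ℝ≥0∞) : (a + b) ^ 2 ≤ 2 * (a ^ 2 + b ^ 2) := by
  have h := ENNReal.rpow_add_le_mul_rpow_add_rpow a b one_le_two
  norm_num at h
  exact h

lemma tendsto_zero_of_sq_le {ι : Type*} {l : Filter ι} {u v : ι → ℝ≥0∞} (hv : Tendsto v l (𝓝 0))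
    (h : ∀ i, u i ^ 2 ≤ v i) : Tendsto u l (𝓝 0) := by
  have hsqrt := ((ENNReal.continuous_rpow_const (y := 1 / 2)).tendsto 0).comp hv
  rw [ENNReal.zero_rpow_of_pos (by norm_num)] at hsqrt
  refine tendsto_of_tendsto_of_tendsto_of_le_of_le tendsto_const_nhds hsqrt (fun _ => zero_le)
    fun i => ?_
  rw [Function.comp_apply, one_div, ENNReal.le_rpow_inv_iff two_pos]
  exact_mod_cast h i

lemma tendsto_lintegral_enorm_mul_of_sq {ι Z : Type*} [MeasurableSpace Z] {ν : Measure Z}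
    {l : Filter ι} {u v : ι → Z → ℝ} (hu : ∀ i, Measurable (u i))
    (hv : ∀ i, Measurable (v i)) (hu0 : Tendsto (fun i => ∫⁻ z, ‖u i z‖ₑ ^ 2 ∂ν) l (𝓝 0))
    {B : ℝ≥0∞} (hB : B ≠ ∞) (hvB : Tendsto (fun i => ∫⁻ z, ‖v i z‖ₑ ^ 2 ∂ν) l (𝓝 B)) :
    Tendsto (fun i => ∫⁻ z, ‖u i z * v i z‖ₑ ∂ν) l (𝓝 0) := by
  refine tendsto_zero_of_sq_le (v := fun i => (∫⁻ z, ‖u i z‖ₑ ^ 2 ∂ν) * ∫⁻ z, ‖v i z‖ₑ ^ 2 ∂ν)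
    ?_ fun i => ?_
  · simpa using ENNReal.Tendsto.mul hu0 (Or.inr hB) hvB (Or.inr ENNReal.zero_ne_top)
  · simpa only [enorm_mul] using
      lintegral_mul_sq_le (hu i).enorm.aemeasurable (hv i).enorm.aemeasurable

/-- Continuity at `p₀` of a parametric statistic `p ↦ f p`, as a map into `L²(ν)`. Only `f p₀` is
required to be square integrable. -/
structure IsL2ContinuousAt {P Z : Type*} [TopologicalSpace P] [MeasurableSpace P]
    [MeasurableSpace Z] (ν : Measure Z) (f : P → Z → ℝ) (p₀ : P) : Prop where
  measurable : Measurable fun q : P × Z => f q.1 q.2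
  memLp : MemLp (f p₀) 2 ν
  tendsto : Tendsto (fun p => ∫⁻ z, ‖f p z - f p₀ z‖ₑ ^ 2 ∂ν) (𝓝 p₀) (𝓝 0)

variable {P Z : Type*} [TopologicalSpace P] [MeasurableSpace P] [MeasurableSpace Z]
  {ν : Measure Z} {p₀ : P} {f g : P → Z → ℝ}

lemma lintegral_enorm_sq_ne_top_of_memLp {v : Z → ℝ} (hv : MemLp v 2 ν) :
    ∫⁻ z, ‖v z‖ₑ ^ 2 ∂ν ≠ ∞ := by
  simpa using ((eLpNorm_lt_top_iff_lintegral_rpow_enorm_lt_top two_ne_zero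
    ENNReal.ofNat_ne_top).1 hv.2).ne

lemma isL2ContinuousAt_const [IsFiniteMeasure ν] (c : ℝ) :
    IsL2ContinuousAt ν (fun _ _ => c) p₀ where
  measurable := measurable_const
  memLp := memLp_const c
  tendsto := by simp

lemma IsL2ContinuousAt.measurable_apply (hf : IsL2ContinuousAt ν f p₀) (p : P) :
    Measurable (f p) :=
  hf.measurable.comp measurable_prodMk_left

lemma IsL2ContinuousAt.tendsto_lintegral_enorm_mul_sub_mul (hf : IsL2ContinuousAt ν f p₀)
    (hg : IsL2ContinuousAt ν g p₀) :
    Tendsto (fun p => ∫⁻ z, ‖f p z * g p z - f p₀ z * g p₀ z‖ₑ ∂ν) (𝓝 p₀) (𝓝 0) := by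
  let u (p : P) (z : Z) : ℝ := f p z - f p₀ z
  let v (p : P) (z : Z) : ℝ := g p z - g p₀ z
  have hu (p : P) : Measurable (u p) := (hf.measurable_apply p).sub (hf.measurable_apply p₀)
  have hv (p : P) : Measurable (v p) := (hg.measurable_apply p).sub (hg.measurable_apply p₀)
  have huv := tendsto_lintegral_enorm_mul_of_sq hu hv hf.tendsto ENNReal.zero_ne_top hg.tendsto
  have hug := tendsto_lintegral_enorm_mul_of_sq hu (fun _ => hg.measurable_apply p₀) hf.tendsto
    (lintegral_enorm_sq_ne_top_of_memLp hg.memLp) tendsto_const_nhds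
  have hvf := tendsto_lintegral_enorm_mul_of_sq hv (fun _ => hf.measurable_apply p₀) hg.tendsto
    (lintegral_enorm_sq_ne_top_of_memLp hf.memLp) tendsto_const_nhds
  refine tendsto_of_tendsto_of_tendsto_of_le_of_le tendsto_const_nhds
    (by simpa only [add_zero] using (huv.add hug).add hvf) (fun _ => zero_le) fun p => ?_
  dsimp only
  have hgp := hg.measurable_apply p₀
  have hup := hu p
  have hvp := hv p
  rw [← lintegral_add_left (by fun_prop), ← lintegral_add_left (by fun_prop)]
  refine lintegral_mono fun z => ?_
  have hsplit : f p z * g p z - f p₀ z * g p₀ z =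
      u p z * v p z + u p z * g p₀ z + v p z * f p₀ z := by
    simp only [u, v]
    ring
  rw [hsplit]
  exact (enorm_add_le _ _).trans (add_le_add_left (enorm_add_le _ _) _)

end SquareMean

namespace Model

section OutcomeLaw

variable {d : ℕ} {𝒳 𝒜 : Type*} [MeasurableSpace 𝒳] [MeasurableSpace 𝒜]

/-- The observation made when action `a` is taken in the environment state `p`. -/
def slot (a : 𝒜) (p : 𝒳 × (𝒜 → ℝ)) : 𝒳 × 𝒜 × ℝ := (p.1, a, p.2 a)

@[fun_prop]
lemma measurable_slot (a : 𝒜) : Measurable (slot (𝒳 := 𝒳) a) := by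
  unfold slot
  fun_prop

section Fintype

variable [Fintype 𝒜]

/-- The sum over all actions of the law of the corresponding observation. It dominates the law of
the observation under every policy, the density being the `propensity`. -/
noncomputable def outcomeLaw (M : Model d 𝒳 𝒜) : Measure (𝒳 × 𝒜 × ℝ) := ∑ a, M.env.map (slot a)

instance (M : Model d 𝒳 𝒜) : IsFiniteMeasure M.outcomeLaw := by
  unfold outcomeLaw
  infer_instance

lemma lintegral_outcomeLaw (M : Model d 𝒳 𝒜) {f : 𝒳 × 𝒜 × ℝ → ℝ≥0∞} (hf : Measurable f) :
    ∫⁻ z, f z ∂M.outcomeLaw = ∑ a, ∫⁻ p, f (slot a p) ∂M.env := by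
  rw [outcomeLaw, lintegral_finsetSum_measure]
  exact Finset.sum_congr rfl fun a _ => lintegral_map hf (measurable_slot a)

lemma lintegral_outcomeLaw_eq_condKernel (M : Model d 𝒳 𝒜) {f : 𝒳 × 𝒜 × ℝ → ℝ≥0∞}
    (hf : Measurable f) :
    ∫⁻ z, f z ∂M.outcomeLaw =
      ∑ a, ∫⁻ x, ∫⁻ y, f (x, a, y a) ∂(M.env.condKernel x) ∂M.env.fst := by
  rw [M.lintegral_outcomeLaw hf]
  exact Finset.sum_congr rfl fun a _ =>
    (Measure.lintegral_condKernel (hf.comp (measurable_slot a))).symm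

lemma lintegral_mul_outcomeLaw_le (M : Model d 𝒳 𝒜) {h : 𝒳 × 𝒜 → ℝ≥0∞} (hh : Measurable h)
    {f : 𝒳 × 𝒜 × ℝ → ℝ≥0∞} (hf : Measurable f) {B : 𝒳 → ℝ≥0∞}
    (hB : ∀ᵐ x ∂M.env.fst, ∀ a, ∫⁻ y, f (x, a, y a) ∂(M.env.condKernel x) ≤ B x) :
    ∫⁻ z, h (z.1, z.2.1) * f z ∂M.outcomeLaw ≤ ∑ a, ∫⁻ x, h (x, a) * B x ∂M.env.fst := by
  rw [M.lintegral_outcomeLaw_eq_condKernel (by fun_prop)]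
  gcongr 1 with a
  refine lintegral_mono_ae (hB.mono fun x hx => ?_)
  dsimp only
  rw [lintegral_const_mul _ (by fun_prop)]
  gcongr
  exact hx a

lemma lintegral_outcomeLaw_le (M : Model d 𝒳 𝒜) {φ : 𝒳 → ℝ} (hφ : ∀ x, 0 ≤ φ x)
    (hφi : Integrable φ M.env.fst) {f : 𝒳 × 𝒜 × ℝ → ℝ≥0∞} (hf : Measurable f) {c : ℝ}
    (hc : 0 ≤ c) (h : ∀ᵐ x ∂M.env.fst, ∀ a, ∫⁻ y, f (x, a, y a) ∂(M.env.condKernel x) ≤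
      ENNReal.ofReal (φ x * c)) :
    ∫⁻ z, f z ∂M.outcomeLaw ≤
      ENNReal.ofReal (Fintype.card 𝒜 * (∫ x, φ x ∂M.env.fst) * c) :=
  calc ∫⁻ z, f z ∂M.outcomeLaw
      ≤ ∑ _a : 𝒜, ∫⁻ x, ENNReal.ofReal (φ x * c) ∂M.env.fst := by
        simpa only [one_mul] using
          M.lintegral_mul_outcomeLaw_le (h := fun _ => 1) measurable_const hf h
    _ = _ := by
        rw [← ofReal_integral_eq_lintegral_ofReal (hφi.mul_const c)
          (ae_of_all _ fun x => mul_nonneg (hφ x) hc), integral_mul_const, Finset.sum_const,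
          nsmul_eq_mul, Finset.card_univ, mul_assoc, ENNReal.ofReal_mul (Nat.cast_nonneg _),
          ENNReal.ofReal_natCast]

end Fintype

/-- The probability that the policy with parameter `θ` takes the action of the observation `z`,
given its covariate. -/
noncomputable def propensity (M : Model d 𝒳 𝒜) (θ : Param d) (z : 𝒳 × 𝒜) : ℝ :=
  (M.policy (z.1, θ)).real {z.2}

variable [MeasurableSingletonClass 𝒜]

@[fun_prop]
lemma measurable_policy_singleton (M : Model d 𝒳 𝒜) (a : 𝒜) :
    Measurable fun p : 𝒳 × Param d => M.policy p {a} :=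
  M.policy.measurable_coe (measurableSet_singleton a)

section Countable

variable [Countable 𝒜]

lemma measurable_propensity (M : Model d 𝒳 𝒜) (θ : Param d) : Measurable (M.propensity θ) :=
  measurable_from_prod_countable_left fun a =>
    ((M.measurable_policy_singleton a).comp (by fun_prop : Measurable fun x : 𝒳 =>
      (x, θ))).ennreal_toReal

lemma measurable_observe :
    Measurable fun p : (𝒳 × (𝒜 → ℝ)) × 𝒜 => (p.1.1, p.2, p.1.2 p.2) :=
  measurable_from_prod_countable_left measurable_slot

instance (M : Model d 𝒳 𝒜) (θ : Param d) : IsProbabilityMeasure (M.obsLaw θ) :=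
  Measure.isProbabilityMeasure_map measurable_observe.aemeasurable

/-- The law of an observation as a kernel in the parameter of the policy. -/
noncomputable def obsKernel (M : Model d 𝒳 𝒜) : Kernel (Param d) (𝒳 × 𝒜 × ℝ) :=
  (Kernel.const (Param d) M.env ⊗ₖ M.policy.comap
    (fun q : Param d × 𝒳 × (𝒜 → ℝ) => (q.2.1, q.1)) (by fun_prop)).map
    fun p => (p.1.1, p.2, p.1.2 p.2)

lemma obsKernel_apply (M : Model d 𝒳 𝒜) (θ : Param d) : M.obsKernel θ = M.obsLaw θ := by
  rw [obsKernel, Kernel.map_apply _ measurable_observe, Kernel.compProd_apply_eq_compProd_sectR]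
  rfl

instance (M : Model d 𝒳 𝒜) : IsMarkovKernel M.obsKernel :=
  ⟨fun θ => by rw [obsKernel_apply]; infer_instance⟩

end Countable

variable [Fintype 𝒜]

lemma lintegral_obsLaw (M : Model d 𝒳 𝒜) (θ : Param d) {f : 𝒳 × 𝒜 × ℝ → ℝ≥0∞}
    (hf : Measurable f) :
    ∫⁻ z, f z ∂(M.obsLaw θ) = ∫⁻ p, ∑ a, M.policy (p.1, θ) {a} * f (slot a p) ∂M.env := by
  have hm := measurable_observe (𝒳 := 𝒳) (𝒜 := 𝒜)
  rw [obsLaw, lintegral_map hf hm, Measure.lintegral_compProd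
    (f := fun p : (𝒳 × (𝒜 → ℝ)) × 𝒜 => f (p.1.1, p.2, p.1.2 p.2)) (hf.comp hm)]
  refine lintegral_congr fun p => ?_
  rw [lintegral_fintype]
  exact Finset.sum_congr rfl fun a _ => mul_comm _ _

lemma obsLaw_eq_withDensity (M : Model d 𝒳 𝒜) (θ : Param d) :
    M.obsLaw θ =
      M.outcomeLaw.withDensity fun z => ENNReal.ofReal (M.propensity θ (z.1, z.2.1)) := by
  have hp := M.measurable_propensity θ
  refine Measure.ext_of_lintegral _ fun f hf => ?_
  rw [lintegral_withDensity_eq_lintegral_mul _ (by fun_prop) hf,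
    M.lintegral_outcomeLaw (by fun_prop), M.lintegral_obsLaw θ hf, lintegral_finsetSum]
  · simp only [Pi.mul_apply, propensity, ENNReal.ofReal_toReal (measure_ne_top _ _), Measure.real,
      slot]
  · intro a _
    exact ((M.measurable_policy_singleton a).comp (by fun_prop : Measurable
      fun p : 𝒳 × (𝒜 → ℝ) => (p.1, θ))).mul (hf.comp (measurable_slot a))

lemma obsLaw_le_outcomeLaw (M : Model d 𝒳 𝒜) (θ : Param d) : M.obsLaw θ ≤ M.outcomeLaw := by
  rw [obsLaw_eq_withDensity]
  refine (withDensity_mono (ae_of_all _ fun z => ?_)).trans_eq withDensity_one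
  exact ENNReal.ofReal_le_one.2 measureReal_le_one

lemma integral_obsLaw (M : Model d 𝒳 𝒜) (θ : Param d) (f : 𝒳 × 𝒜 × ℝ → ℝ) :
    ∫ z, f z ∂(M.obsLaw θ) = ∫ z, M.propensity θ (z.1, z.2.1) * f z ∂M.outcomeLaw := by
  have hp := M.measurable_propensity θ
  rw [obsLaw_eq_withDensity, integral_withDensity_eq_integral_toReal_smul (by fun_prop)
    (ae_of_all _ fun _ => ENNReal.ofReal_lt_top)]
  simp only [propensity, ENNReal.toReal_ofReal measureReal_nonneg, smul_eq_mul]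

lemma tendsto_integral_obsLaw (M : Model d 𝒳 𝒜) {θstar : Param d} {f : 𝒳 × 𝒜 × ℝ → ℝ}
    (hf : Integrable f M.outcomeLaw)
    (h : Tendsto (fun θ => ∫⁻ z, ‖M.propensity θ (z.1, z.2.1) -
      M.propensity θstar (z.1, z.2.1)‖ₑ * ‖f z‖ₑ ∂M.outcomeLaw) (𝓝 θstar) (𝓝 0)) :
    Tendsto (fun θ => ∫ z, f z ∂(M.obsLaw θ)) (𝓝 θstar) (𝓝 (∫ z, f z ∂(M.obsLaw θstar))) := by
  have hint (θ : Param d) :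
      Integrable (fun z => M.propensity θ (z.1, z.2.1) * f z) M.outcomeLaw := by
    have hp := (M.measurable_propensity θ).comp
      (by fun_prop : Measurable fun z : 𝒳 × 𝒜 × ℝ => (z.1, z.2.1))
    refine hf.bdd_mul (c := 1) hp.aestronglyMeasurable (ae_of_all _ fun z => ?_)
    exact (Real.norm_of_nonneg measureReal_nonneg).trans_le measureReal_le_one
  simp only [integral_obsLaw]
  refine tendsto_integral_of_L1 _ (hint θstar).aestronglyMeasurable
    (Eventually.of_forall hint) ?_
  simpa only [← sub_mul, enorm_mul] using h

end OutcomeLaw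

end Model

lemma enorm_sub_sq_le_two_mul {E : Type*} [SeminormedAddCommGroup E] (x y : E) :
    ‖x - y‖ₑ ^ 2 ≤ 2 * (‖x‖ₑ ^ 2 + ‖y‖ₑ ^ 2) :=
  (pow_le_pow_left' (enorm_sub_le (E := E)) 2).trans (add_sq_le_two_mul _ _)

lemma enorm_sq_eq_ofReal_abs_sq (r : ℝ) : ‖r‖ₑ ^ 2 = ENNReal.ofReal (|r| ^ 2) := by
  rw [Real.enorm_eq_ofReal_abs, ENNReal.ofReal_pow (abs_nonneg r)]

lemma tendsto_lintegral_ofReal_mul {ι X : Type*} [MeasurableSpace X] {ν : Measure X}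
    {l : Filter ι} {φ : X → ℝ} (hφ : ∀ x, 0 ≤ φ x) (hφi : Integrable φ ν) {u : ι → X → ℝ}
    (hum : ∀ i, Measurable (u i)) (hu : ∀ i x, 0 ≤ u i x) {C : ℝ} (huC : ∀ i x, u i x ≤ C)
    (h : Tendsto (fun i => ∫ x, u i x * φ x ∂ν) l (𝓝 0)) :
    Tendsto (fun i => ∫⁻ x, ENNReal.ofReal (u i x) * ENNReal.ofReal (φ x) ∂ν) l (𝓝 0) := by
  have hint (i : ι) : Integrable (fun x => u i x * φ x) ν :=
    hφi.bdd_mul (hum i).aestronglyMeasurable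
      (ae_of_all _ fun x => (Real.norm_of_nonneg (hu i x)).trans_le (huC i x))
  simp only [← ENNReal.ofReal_mul (hu _ _)]
  simpa only [ofReal_integral_eq_lintegral_ofReal (hint _)
    (ae_of_all _ fun x => mul_nonneg (hu _ x) (hφ x)), ENNReal.ofReal_zero] using
    ENNReal.tendsto_ofReal h

namespace Model

section RegularStatistic

variable {d : ℕ} {𝒳 𝒜 : Type*} [MeasurableSpace 𝒳] [MeasurableSpace 𝒜]

lemma measurable_weight_obs (M : Model d 𝒳 𝒜) :
    Measurable fun p : Param d × 𝒳 × 𝒜 × ℝ => M.weight p.1 p.2.1 p.2.2.1 :=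
  M.measurable_weight.comp (by fun_prop : Measurable fun p : Param d × 𝒳 × 𝒜 × ℝ =>
    (p.1, p.2.1, p.2.2.1))

lemma measurable_weight_apply (M : Model d 𝒳 𝒜) (θ : Param d) :
    Measurable fun z : 𝒳 × 𝒜 => M.weight θ z.1 z.2 :=
  M.measurable_weight.comp measurable_prodMk_left

lemma enorm_weight_smul_sq_le {M : Model d 𝒳 𝒜} {C : ℝ} (hw : ∀ θ x a, |M.weight θ x a| ≤ C)
    {E : Type*} [NormedAddCommGroup E] [NormedSpace ℝ E] (θ : Param d) (z : 𝒳 × 𝒜 × ℝ) (v : E) :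
    ‖M.weight θ z.1 z.2.1 • v‖ₑ ^ 2 ≤ ENNReal.ofReal (C ^ 2) * ‖v‖ₑ ^ 2 := by
  rw [enorm_smul, mul_pow, enorm_sq_eq_ofReal_abs_sq]
  gcongr
  exact hw θ z.1 z.2.1

/-- The statistic `k` multiplied by the gradient weight. -/
def weighted (M : Model d 𝒳 𝒜) (k : Param d → 𝒳 × 𝒜 × ℝ → ℝ) (θ : Param d)
    (z : 𝒳 × 𝒜 × ℝ) : ℝ :=
  M.weight θ z.1 z.2.1 * k θ z

lemma measurable_weighted (M : Model d 𝒳 𝒜) {k : Param d → 𝒳 × 𝒜 × ℝ → ℝ}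
    (hk : Measurable fun p : Param d × 𝒳 × 𝒜 × ℝ => k p.1 p.2) :
    Measurable fun p : Param d × 𝒳 × 𝒜 × ℝ => M.weighted k p.1 p.2 :=
  M.measurable_weight_obs.mul hk

lemma abs_propensity_sub_le_one (M : Model d 𝒳 𝒜) (θ θ' : Param d) (z : 𝒳 × 𝒜) :
    |M.propensity θ z - M.propensity θ' z| ≤ 1 :=
  (abs_sub_le_of_le_of_le measureReal_nonneg measureReal_le_one measureReal_nonneg
    measureReal_le_one).trans_eq (sub_zero 1)

variable [Fintype 𝒜]

lemma lintegral_enorm_weight_smul_sq_le {M : Model d 𝒳 𝒜} {C : ℝ}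
    (hw : ∀ θ x a, |M.weight θ x a| ≤ C) {E : Type*} [NormedAddCommGroup E] [NormedSpace ℝ E]
    {v : 𝒳 × 𝒜 × ℝ → E} (hv : Measurable fun z => ‖v z‖ₑ) {φ : 𝒳 → ℝ} (hφ : ∀ x, 0 ≤ φ x)
    (hφi : Integrable φ M.env.fst) {c : ℝ} (hc : 0 ≤ c)
    (h : ∀ᵐ x ∂M.env.fst, ∀ a, ∫⁻ y, ‖v (x, a, y a)‖ₑ ^ 2 ∂(M.env.condKernel x) ≤
      ENNReal.ofReal (φ x * c)) (θ : Param d) :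
    ∫⁻ z, ‖M.weight θ z.1 z.2.1 • v z‖ₑ ^ 2 ∂M.outcomeLaw ≤
      ENNReal.ofReal (C ^ 2 * (Fintype.card 𝒜 * ∫ x, φ x ∂M.env.fst) * c) :=
  calc ∫⁻ z, ‖M.weight θ z.1 z.2.1 • v z‖ₑ ^ 2 ∂M.outcomeLaw
      ≤ ∫⁻ z, ENNReal.ofReal (C ^ 2) * ‖v z‖ₑ ^ 2 ∂M.outcomeLaw :=
        lintegral_mono fun z => enorm_weight_smul_sq_le hw θ z (v z)
    _ ≤ _ := by
        rw [lintegral_const_mul _ (hv.pow_const 2), mul_assoc, ENNReal.ofReal_mul (sq_nonneg C)]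
        gcongr
        exact M.lintegral_outcomeLaw_le hφ hφi (hv.pow_const 2) hc h

lemma tvDist_nonneg (M : Model d 𝒳 𝒜) (θstar θ : Param d) (x : 𝒳) : 0 ≤ M.tvDist θstar x θ := by
  unfold tvDist
  positivity

lemma abs_propensity_sub_le_tvDist (M : Model d 𝒳 𝒜) (θstar θ : Param d) (z : 𝒳 × 𝒜) :
    |M.propensity θ z - M.propensity θstar z| ≤ 2 * M.tvDist θstar z.1 θ := by
  rw [tvDist, ← mul_assoc, mul_one_div_cancel two_ne_zero, one_mul]
  exact Finset.single_le_sum (f := fun a =>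
    |(M.policy (z.1, θ)).real {a} - (M.policy (z.1, θstar)).real {a}|)
    (fun _ _ => abs_nonneg _) (Finset.mem_univ z.2)

lemma tvDist_le_card (M : Model d 𝒳 𝒜) (θstar θ : Param d) (x : 𝒳) :
    M.tvDist θstar x θ ≤ 1 / 2 * Fintype.card 𝒜 := by
  unfold tvDist
  gcongr
  simpa [propensity] using Finset.sum_le_card_nsmul Finset.univ _ 1 fun a _ =>
    M.abs_propensity_sub_le_one θ θstar (x, a)

lemma measurable_tvDist [MeasurableSingletonClass 𝒜] (M : Model d 𝒳 𝒜) (θstar θ : Param d) :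
    Measurable fun x => M.tvDist θstar x θ := by
  have hp (a : 𝒜) (θ : Param d) : Measurable fun x => (M.policy (x, θ)).real {a} :=
    (M.measurable_propensity θ).comp measurable_prodMk_right
  unfold tvDist
  fun_prop

/-- A real-valued statistic `k θ ζ` with the conditional second-moment bound and the continuity
conditions that the model imposes on the entries of the gradient and of the Hessian. -/
structure RegularStatistic (M : Model d 𝒳 𝒜) (θstar : Param d) (φ : 𝒳 → ℝ)
    (k : Param d → 𝒳 × 𝒜 × ℝ → ℝ) : Prop where
  measurable : Measurable fun p : Param d × 𝒳 × 𝒜 × ℝ => k p.1 p.2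
  nonneg : ∀ x, 0 ≤ φ x
  integrable : Integrable φ M.env.fst
  bound : ∀ᵐ x ∂M.env.fst, ∀ a θ, ∫⁻ y, ‖k θ (x, a, y a)‖ₑ ^ 2 ∂(M.env.condKernel x) ≤
    ENNReal.ofReal (φ x * (1 + ‖θ - θstar‖ ^ 2))
  tv : Tendsto (fun θ => ∫ x, M.tvDist θstar x θ * φ x ∂M.env.fst) (𝓝 θstar) (𝓝 0)
  cont : ∀ᵐ x ∂M.env.fst, ∀ a, Tendsto
    (fun θ => ∫⁻ y, ‖k θ (x, a, y a) - k θstar (x, a, y a)‖ₑ ^ 2 ∂(M.env.condKernel x))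
    (𝓝 θstar) (𝓝 0)
  weight : ∀ a, Tendsto
    (fun θ => ∫ x, |M.weight θ x a - M.weight θstar x a| ^ 2 * φ x ∂M.env.fst) (𝓝 θstar) (𝓝 0)

namespace RegularStatistic

variable {M : Model d 𝒳 𝒜} {θstar : Param d} {φ : 𝒳 → ℝ} {k : Param d → 𝒳 × 𝒜 × ℝ → ℝ} {C : ℝ}

lemma measurable_apply (hk : M.RegularStatistic θstar φ k) (θ : Param d) : Measurable (k θ) :=
  hk.measurable.comp measurable_prodMk_left

lemma lintegral_weight_mul_sq_le (hk : M.RegularStatistic θstar φ k)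
    (hw : ∀ θ x a, |M.weight θ x a| ≤ C) (θ' θ : Param d) :
    ∫⁻ z, ‖M.weight θ' z.1 z.2.1 * k θ z‖ₑ ^ 2 ∂M.outcomeLaw ≤
      ENNReal.ofReal (C ^ 2 * (Fintype.card 𝒜 * ∫ x, φ x ∂M.env.fst) * (1 + ‖θ - θstar‖ ^ 2)) :=
  lintegral_enorm_weight_smul_sq_le hw (hk.measurable_apply θ).enorm hk.nonneg hk.integrable
    (by positivity) (hk.bound.mono fun _ hx a => hx a θ) θ'

lemma memLp_weight_mul (hk : M.RegularStatistic θstar φ k) (hw : ∀ θ x a, |M.weight θ x a| ≤ C)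
    (θ' θ : Param d) : MemLp (fun z => M.weight θ' z.1 z.2.1 * k θ z) 2 M.outcomeLaw :=
  memLp_two_of_lintegral_sq_le
    ((M.measurable_weight_obs.comp measurable_prodMk_left).mul
      (hk.measurable_apply θ)).aestronglyMeasurable (hk.lintegral_weight_mul_sq_le hw θ' θ)

lemma lintegral_condKernel_sub_sq_le (hk : M.RegularStatistic θstar φ k) :
    ∀ᵐ x ∂M.env.fst, ∀ a θ, ‖θ - θstar‖ ≤ 1 →
      ∫⁻ y, ‖k θ (x, a, y a) - k θstar (x, a, y a)‖ₑ ^ 2 ∂(M.env.condKernel x) ≤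
        2 * (ENNReal.ofReal (φ x * 2) + ENNReal.ofReal (φ x)) := by
  filter_upwards [hk.bound] with x hx a θ hθ
  have hm : Measurable fun y : 𝒜 → ℝ => ‖k θ (x, a, y a)‖ₑ ^ 2 :=
    ((hk.measurable_apply θ).comp ((measurable_slot a).comp measurable_prodMk_left)).enorm.pow_const
      2
  calc ∫⁻ y, ‖k θ (x, a, y a) - k θstar (x, a, y a)‖ₑ ^ 2 ∂(M.env.condKernel x)
      ≤ ∫⁻ y, 2 * (‖k θ (x, a, y a)‖ₑ ^ 2 + ‖k θstar (x, a, y a)‖ₑ ^ 2)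
          ∂(M.env.condKernel x) := lintegral_mono fun y => enorm_sub_sq_le_two_mul _ _
    _ = 2 * (∫⁻ y, ‖k θ (x, a, y a)‖ₑ ^ 2 ∂(M.env.condKernel x) +
          ∫⁻ y, ‖k θstar (x, a, y a)‖ₑ ^ 2 ∂(M.env.condKernel x)) := by
        rw [lintegral_const_mul' _ _ (by simp), lintegral_add_left hm]
    _ ≤ _ := by
        gcongr
        · refine (hx a θ).trans (ENNReal.ofReal_le_ofReal ?_)
          gcongr
          · exact hk.nonneg x
          · linarith [pow_le_one₀ (n := 2) (norm_nonneg (θ - θstar)) hθ]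
        · simpa using hx a θstar

lemma tendsto_lintegral_sub_sq (hk : M.RegularStatistic θstar φ k) :
    Tendsto (fun θ => ∫⁻ z, ‖k θ z - k θstar z‖ₑ ^ 2 ∂M.outcomeLaw) (𝓝 θstar) (𝓝 0) := by
  have hm (θ : Param d) : Measurable fun z => ‖k θ z - k θstar z‖ₑ ^ 2 :=
    ((hk.measurable_apply θ).sub (hk.measurable_apply θstar)).enorm.pow_const 2
  simp only [M.lintegral_outcomeLaw_eq_condKernel (hm _)]
  rw [← Finset.sum_const_zero (s := (Finset.univ : Finset 𝒜))]
  refine tendsto_finsetSum _ fun a _ => ?_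
  rw [← lintegral_zero (μ := M.env.fst)]
  refine tendsto_lintegral_filter_of_dominated_convergence
    (fun x => 2 * (ENNReal.ofReal (φ x * 2) + ENNReal.ofReal (φ x)))
    (Eventually.of_forall fun θ => ?_) ?_ ?_ ?_
  · exact Measurable.lintegral_kernel_prod_right'
      (f := fun p : 𝒳 × (𝒜 → ℝ) => ‖k θ (slot a p) - k θstar (slot a p)‖ₑ ^ 2)
      ((hm θ).comp (measurable_slot a))
  · filter_upwards [Metric.closedBall_mem_nhds θstar one_pos] with θ hθ
    filter_upwards [hk.lintegral_condKernel_sub_sq_le] with x hx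
    exact hx a θ (by rwa [← dist_eq_norm])
  · have h2 := (hk.integrable.mul_const 2).lintegral_lt_top
    rw [lintegral_const_mul' _ _ (by simp),
      lintegral_add_left' (hk.integrable.mul_const 2).aemeasurable.ennreal_ofReal]
    exact ENNReal.mul_ne_top (by simp)
      (ENNReal.add_lt_top.2 ⟨h2, hk.integrable.lintegral_lt_top⟩).ne
  · filter_upwards [hk.cont] with x hx using hx a

lemma tendsto_lintegral_mul_sq (hk : M.RegularStatistic θstar φ k) {u : Param d → 𝒳 × 𝒜 → ℝ}
    (hum : ∀ θ, Measurable (u θ)) (hu : ∀ θ z, 0 ≤ u θ z) {B : ℝ} (huB : ∀ θ z, u θ z ≤ B)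
    (h : ∀ a, Tendsto (fun θ => ∫ x, u θ (x, a) * φ x ∂M.env.fst) (𝓝 θstar) (𝓝 0)) :
    Tendsto (fun θ => ∫⁻ z, ENNReal.ofReal (u θ (z.1, z.2.1)) * ‖k θstar z‖ₑ ^ 2 ∂M.outcomeLaw)
      (𝓝 θstar) (𝓝 0) := by
  have hsum : Tendsto (fun θ => ∑ a, ∫⁻ x, ENNReal.ofReal (u θ (x, a)) * ENNReal.ofReal (φ x)
      ∂M.env.fst) (𝓝 θstar) (𝓝 0) := by
    rw [← Finset.sum_const_zero (s := (Finset.univ : Finset 𝒜))]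
    exact tendsto_finsetSum _ fun a _ => tendsto_lintegral_ofReal_mul hk.nonneg hk.integrable
      (fun θ => (hum θ).comp measurable_prodMk_right) (fun θ x => hu θ (x, a))
      (fun θ x => huB θ (x, a)) (h a)
  refine tendsto_of_tendsto_of_tendsto_of_le_of_le tendsto_const_nhds hsum (fun _ => zero_le)
    fun θ => ?_
  refine M.lintegral_mul_outcomeLaw_le (h := fun z => ENNReal.ofReal (u θ z))
    (hum θ).ennreal_ofReal ((hk.measurable_apply θstar).enorm.pow_const 2) ?_
  filter_upwards [hk.bound] with x hx a
  simpa using hx a θstar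

lemma tendsto_lintegral_weight_sub_mul_sq (hk : M.RegularStatistic θstar φ k)
    (hw : ∀ θ x a, |M.weight θ x a| ≤ C) :
    Tendsto (fun θ => ∫⁻ z, ‖(M.weight θ z.1 z.2.1 - M.weight θstar z.1 z.2.1) *
      k θstar z‖ₑ ^ 2 ∂M.outcomeLaw) (𝓝 θstar) (𝓝 0) := by
  simp only [enorm_mul, mul_pow, enorm_sq_eq_ofReal_abs_sq (_ - _)]
  refine hk.tendsto_lintegral_mul_sq
    (u := fun θ z => |M.weight θ z.1 z.2 - M.weight θstar z.1 z.2| ^ 2) (B := (C + C) ^ 2)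
    (fun θ => ((M.measurable_weight_apply θ).sub (M.measurable_weight_apply θstar)).abs.pow_const 2)
    (fun θ z => sq_nonneg _) (fun θ z => ?_) hk.weight
  gcongr
  exact (abs_sub _ _).trans (add_le_add (hw _ _ _) (hw _ _ _))

lemma isL2ContinuousAt_weighted (hk : M.RegularStatistic θstar φ k)
    (hw : ∀ θ x a, |M.weight θ x a| ≤ C) :
    IsL2ContinuousAt M.outcomeLaw (M.weighted k) θstar where
  measurable := M.measurable_weighted hk.measurable
  memLp := hk.memLp_weight_mul hw θstar θstar
  tendsto := by
    have hlim := ENNReal.Tendsto.const_mul ((ENNReal.Tendsto.const_mul hk.tendsto_lintegral_sub_sq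
      (Or.inr (ENNReal.ofReal_ne_top (r := C ^ 2)))).add
      (hk.tendsto_lintegral_weight_sub_mul_sq hw)) (Or.inr ENNReal.ofNat_ne_top : _ ∨ 2 ≠ ∞)
    simp only [mul_zero, add_zero] at hlim
    refine tendsto_of_tendsto_of_tendsto_of_le_of_le tendsto_const_nhds hlim (fun _ => zero_le)
      fun θ => ?_
    have hm : Measurable fun z => ENNReal.ofReal (C ^ 2) * ‖k θ z - k θstar z‖ₑ ^ 2 :=
      (((hk.measurable_apply θ).sub (hk.measurable_apply θstar)).enorm.pow_const 2).const_mul _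
    dsimp only
    rw [← lintegral_const_mul' _ _ ENNReal.ofReal_ne_top, ← lintegral_add_left hm,
      ← lintegral_const_mul' _ _ ENNReal.ofNat_ne_top]
    refine lintegral_mono fun z => ?_
    have hsplit : M.weighted k θ z - M.weighted k θstar z =
        M.weight θ z.1 z.2.1 • (k θ z - k θstar z) +
          (M.weight θ z.1 z.2.1 - M.weight θstar z.1 z.2.1) * k θstar z := by
      simp only [weighted, smul_eq_mul]
      ring
    rw [hsplit]
    refine (pow_le_pow_left' (enorm_add_le _ _) 2).trans ((add_sq_le_two_mul _ _).trans ?_)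
    gcongr
    exact enorm_weight_smul_sq_le hw θ z _

variable [MeasurableSingletonClass 𝒜]

lemma tendsto_lintegral_propensity_sub_mul_sq (hk : M.RegularStatistic θstar φ k) :
    Tendsto (fun θ => ∫⁻ z, ‖(M.propensity θ (z.1, z.2.1) - M.propensity θstar (z.1, z.2.1)) *
      k θstar z‖ₑ ^ 2 ∂M.outcomeLaw) (𝓝 θstar) (𝓝 0) := by
  have htv := hk.tendsto_lintegral_mul_sq (u := fun θ z => 2 * M.tvDist θstar z.1 θ)
    (fun θ => ((M.measurable_tvDist θstar θ).comp measurable_fst).const_mul 2)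
    (fun θ z => mul_nonneg zero_le_two (M.tvDist_nonneg θstar θ z.1))
    (fun θ z => mul_le_mul_of_nonneg_left (M.tvDist_le_card θstar θ z.1) zero_le_two) fun _ => by
      simpa only [mul_assoc, integral_const_mul, mul_zero] using hk.tv.const_mul 2
  refine tendsto_of_tendsto_of_tendsto_of_le_of_le tendsto_const_nhds htv (fun _ => zero_le)
    fun θ => lintegral_mono fun z => ?_
  dsimp only
  rw [enorm_mul, mul_pow, enorm_sq_eq_ofReal_abs_sq (_ - _)]
  gcongr
  exact (pow_le_of_le_one (abs_nonneg _) (M.abs_propensity_sub_le_one _ _ _) two_ne_zero).trans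
    (M.abs_propensity_sub_le_tvDist θstar θ (z.1, z.2.1))

variable {g : Param d → 𝒳 × 𝒜 × ℝ → ℝ}

lemma tendsto_integral_obsLaw_weighted_mul (hk : M.RegularStatistic θstar φ k)
    (hw : ∀ θ x a, |M.weight θ x a| ≤ C) (hg : IsL2ContinuousAt M.outcomeLaw g θstar) :
    Tendsto (fun θ => ∫ z, M.weighted k θstar z * g θstar z ∂(M.obsLaw θ)) (𝓝 θstar)
      (𝓝 (∫ z, M.weighted k θstar z * g θstar z ∂(M.obsLaw θstar))) := by
  have hf := hk.isL2ContinuousAt_weighted hw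
  refine M.tendsto_integral_obsLaw (hf.memLp.integrable_mul hg.memLp) ?_
  have hp (θ : Param d) : Measurable fun z : 𝒳 × 𝒜 × ℝ => M.propensity θ (z.1, z.2.1) :=
    (M.measurable_propensity θ).comp (by fun_prop)
  have hpk := ENNReal.Tendsto.const_mul hk.tendsto_lintegral_propensity_sub_mul_sq
    (Or.inr (ENNReal.ofReal_ne_top (r := C ^ 2)))
  rw [mul_zero] at hpk
  simp only [← enorm_mul, ← mul_assoc]
  refine tendsto_lintegral_enorm_mul_of_sq
    (fun θ => ((hp θ).sub (hp θstar)).mul (hf.measurable_apply θstar))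
    (fun _ => hg.measurable_apply θstar) ?_ (lintegral_enorm_sq_ne_top_of_memLp hg.memLp)
    tendsto_const_nhds
  refine tendsto_of_tendsto_of_tendsto_of_le_of_le tendsto_const_nhds hpk (fun _ => zero_le)
    fun θ => ?_
  dsimp only
  rw [← lintegral_const_mul' _ _ ENNReal.ofReal_ne_top]
  refine lintegral_mono fun z => ?_
  dsimp only
  rw [weighted, mul_left_comm]
  exact enorm_weight_smul_sq_le hw θstar z _

lemma tendsto_lintegral_obsLaw_weighted_mul_sub (hk : M.RegularStatistic θstar φ k)
    (hw : ∀ θ x a, |M.weight θ x a| ≤ C) (hg : IsL2ContinuousAt M.outcomeLaw g θstar) :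
    Tendsto (fun θ => ∫⁻ z, ‖M.weighted k θ z * g θ z - M.weighted k θstar z * g θstar z‖ₑ
      ∂(M.obsLaw θ)) (𝓝 θstar) (𝓝 0) :=
  tendsto_of_tendsto_of_tendsto_of_le_of_le tendsto_const_nhds
    ((hk.isL2ContinuousAt_weighted hw).tendsto_lintegral_enorm_mul_sub_mul hg)
    (fun _ => zero_le) fun θ => lintegral_mono' (M.obsLaw_le_outcomeLaw θ) le_rfl

end RegularStatistic

end RegularStatistic

end Model

lemma norm_apply_le_l2_opNorm {m n : Type*} [Fintype m] [Fintype n] [DecidableEq n]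
    (B : Matrix m n ℝ) (i : m) (j : n) : ‖B i j‖ ≤ ‖B‖ := by
  have h := Matrix.l2_opNorm_mulVec B (EuclideanSpace.single j 1)
  rw [PiLp.norm_single, norm_one, mul_one] at h
  refine le_trans ?_ ((PiLp.norm_apply_le _ i).trans h)
  simp

namespace Model

variable {d : ℕ} {𝒳 𝒜 : Type*} [MeasurableSpace 𝒳] [MeasurableSpace 𝒜]
  {M : Model d 𝒳 𝒜} {θstar : Param d} {φ ψ : 𝒳 → ℝ} {C : ℝ}

lemma measurable_gradLoss (hd : ∀ ζ, Differentiable ℝ fun θ => M.loss θ ζ) :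
    Measurable fun p : Param d × 𝒳 × 𝒜 × ℝ => M.gradLoss p.1 p.2 :=
  measurable_gradient_of_differentiable M.measurable_loss hd

variable [Fintype 𝒜]

lemma regularStatistic_gradLoss (hd : ∀ ζ, Differentiable ℝ fun θ => M.loss θ ζ)
    (h4 : M.GradientMoment θstar φ) (h5 : M.GradientContinuity θstar φ) (i : Fin d) :
    M.RegularStatistic θstar φ fun θ z => M.gradLoss θ z i where
  measurable := by
    have := measurable_gradLoss hd
    fun_prop
  nonneg := h4.nonneg
  integrable := h4.integrable
  bound := h4.bound.mono fun x hx a θ => le_trans (lintegral_mono fun y => by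
    gcongr
    exact enorm_le_iff_norm_le.2 (PiLp.norm_apply_le _ i)) (hx a θ)
  tv := h5.tv
  cont := h5.grad.mono fun x hx a =>
    tendsto_of_tendsto_of_tendsto_of_le_of_le tendsto_const_nhds (hx a) (fun _ => zero_le)
      fun θ => lintegral_mono fun y => pow_le_pow_left' (enorm_le_iff_norm_le.2
        (PiLp.norm_apply_le (M.gradLoss θ (x, a, y a) - M.gradLoss θstar (x, a, y a)) i)) 2
  weight := h5.weight

lemma regularStatistic_hessLoss (h6 : M.HessianConditions θstar ψ) (i j : Fin d) :
    M.RegularStatistic θstar ψ fun θ z => M.hessLoss θ z i j where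
  measurable := measurable_hessian_apply_of_differentiable M.measurable_loss
    h6.differentiable_loss h6.differentiable_grad i j
  nonneg := h6.nonneg
  integrable := h6.integrable
  bound := h6.bound.mono fun x hx a θ => le_trans (lintegral_mono fun y => by
    gcongr
    exact enorm_le_iff_norm_le.2 (norm_apply_le_l2_opNorm _ i j)) (hx a θ)
  tv := h6.tv
  cont := h6.hess.mono fun x hx a =>
    tendsto_of_tendsto_of_tendsto_of_le_of_le tendsto_const_nhds (hx a) (fun _ => zero_le)
      fun θ => lintegral_mono fun y => pow_le_pow_left' (enorm_le_iff_norm_le.2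
        (norm_apply_le_l2_opNorm
          (M.hessLoss θ (x, a, y a) - M.hessLoss θstar (x, a, y a)) i j)) 2
  weight := h6.weight

variable [MeasurableSingletonClass 𝒜]

namespace RegularStatistic

variable {k : Param d → 𝒳 × 𝒜 × ℝ → ℝ}

lemma integrable_weight_mul (hk : M.RegularStatistic θstar φ k)
    (hw : ∀ θ x a, |M.weight θ x a| ≤ C) (θ' θ : Param d) :
    Integrable (fun z => M.weight θ' z.1 z.2.1 * k θ z) (M.obsLaw θ') :=
  ((hk.memLp_weight_mul hw θ' θ).mono_measure (M.obsLaw_le_outcomeLaw θ')).integrable one_le_two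

lemma tendsto_integral_obsLaw_weighted (hk : M.RegularStatistic θstar φ k)
    (hw : ∀ θ x a, |M.weight θ x a| ≤ C) :
    Tendsto (fun θ => ∫ z, M.weighted k θ z ∂(M.obsLaw θ)) (𝓝 θstar)
      (𝓝 (∫ z, M.weighted k θstar z ∂(M.obsLaw θstar))) := by
  have hone : IsL2ContinuousAt M.outcomeLaw (fun _ _ => (1 : ℝ)) θstar :=
    isL2ContinuousAt_const 1
  have hint (θ : Param d) : Integrable (M.weighted k θ) M.outcomeLaw :=
    (hk.memLp_weight_mul hw θ θ).integrable one_le_two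
  have hfix := hk.tendsto_integral_obsLaw_weighted_mul hw hone
  have hsub := hk.tendsto_lintegral_obsLaw_weighted_mul_sub hw hone
  simp only [mul_one] at hfix hsub
  have hdiff : Tendsto (fun θ => ∫ z, (M.weighted k θ z - M.weighted k θstar z) ∂(M.obsLaw θ))
      (𝓝 θstar) (𝓝 0) := by
    rw [tendsto_zero_iff_enorm_tendsto_zero]
    exact tendsto_of_tendsto_of_tendsto_of_le_of_le tendsto_const_nhds hsub (fun _ => zero_le)
      fun θ => enorm_integral_le_lintegral_enorm _
  simpa only [integral_sub ((hint _).mono_measure (M.obsLaw_le_outcomeLaw _))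
    ((hint θstar).mono_measure (M.obsLaw_le_outcomeLaw _)), sub_add_cancel, zero_add] using
    hdiff.add hfix

lemma lintegral_obsLaw_weight_mul_segment_sq_le (hk : M.RegularStatistic θstar φ k)
    (hw : ∀ θ x a, |M.weight θ x a| ≤ C) (θ' θ v : Param d) {s : ℝ} (hs : s ∈ Set.Icc 0 1) :
    ∫⁻ z, ‖M.weight θ' z.1 z.2.1 * k (θ + s • v) z‖ₑ ^ 2 ∂(M.obsLaw θ') ≤
      ENNReal.ofReal (C ^ 2 * (Fintype.card 𝒜 * ∫ x, φ x ∂M.env.fst) *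
        (1 + (‖θ - θstar‖ + ‖v‖) ^ 2)) := by
  refine (lintegral_mono' (M.obsLaw_le_outcomeLaw θ') le_rfl).trans
    ((hk.lintegral_weight_mul_sq_le hw θ' (θ + s • v)).trans (ENNReal.ofReal_le_ofReal ?_))
  have hφ : 0 ≤ ∫ x, φ x ∂M.env.fst := integral_nonneg hk.nonneg
  gcongr
  rw [add_sub_right_comm]
  refine (norm_add_le _ _).trans ?_
  gcongr
  rw [norm_smul, Real.norm_of_nonneg hs.1]
  exact mul_le_of_le_one_left (norm_nonneg v) hs.2

lemma fderiv_integral_weight_mul {L : Param d → 𝒳 × 𝒜 × ℝ → ℝ}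
    (hLm : Measurable fun p : Param d × 𝒳 × 𝒜 × ℝ => L p.1 p.2)
    (hLd : ∀ z, Differentiable ℝ fun θ => L θ z) {v : Param d}
    (hk : M.RegularStatistic θstar φ fun θ z => fderiv ℝ (fun ϑ => L ϑ z) θ v)
    (hw : ∀ θ x a, |M.weight θ x a| ≤ C) {θ' θ : Param d}
    (hint : ∀ θ, Integrable (fun z => M.weight θ' z.1 z.2.1 * L θ z) (M.obsLaw θ'))
    (hd : DifferentiableAt ℝ (fun θ => ∫ z, M.weight θ' z.1 z.2.1 * L θ z ∂(M.obsLaw θ')) θ) :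
    fderiv ℝ (fun θ => ∫ z, M.weight θ' z.1 z.2.1 * L θ z ∂(M.obsLaw θ')) θ v =
      ∫ z, M.weight θ' z.1 z.2.1 * fderiv ℝ (fun ϑ => L ϑ z) θ v ∂(M.obsLaw θ') := by
  have hline : Measurable fun p : ℝ × 𝒳 × 𝒜 × ℝ => (θ + p.1 • v, p.2) := by fun_prop
  have hwm : Measurable fun z : 𝒳 × 𝒜 × ℝ => M.weight θ' z.1 z.2.1 :=
    M.measurable_weight_obs.comp measurable_prodMk_left
  have hφ : 0 ≤ ∫ x, φ x ∂M.env.fst := integral_nonneg hk.nonneg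
  have hderiv (z : 𝒳 × 𝒜 × ℝ) (s : ℝ) :
      HasDerivAt (fun s : ℝ => M.weight θ' z.1 z.2.1 * L (θ + s • v) z)
        (M.weight θ' z.1 z.2.1 * fderiv ℝ (fun ϑ => L ϑ z) (θ + s • v) v) s := by
    have hl : HasDerivAt (fun s : ℝ => θ + s • v) v s := by
      simpa using ((hasDerivAt_id s).smul_const v).const_add θ
    exact ((hLd z (θ + s • v)).hasFDerivAt.comp_hasDerivAt s hl).const_mul _
  simpa using eq_integral_of_hasDerivAt_of_lintegral_sq_le
    ((hwm.comp measurable_snd).mul (hLm.comp hline)) hderiv (by positivity)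
    (fun s hs => hk.lintegral_obsLaw_weight_mul_segment_sq_le hw θ' θ v hs) (fun s => hint _)
    (hd.hasFDerivAt.hasLineDerivAt v)

end RegularStatistic

end Model

section Conditioning

variable {Ω : Type*} {m m0 : MeasurableSpace Ω} {μ : Measure Ω} [IsFiniteMeasure μ]

lemma trim_restrict_eq_trim_withDensity_of_condExp (hm : m ≤ m0) {t : Set Ω}
    (ht : MeasurableSet t) {p : Ω → ℝ} (hp : ∀ ω, 0 ≤ p ω)
    (h : μ[t.indicator (fun _ => (1 : ℝ)) | m] =ᵐ[μ] p) :
    (μ.restrict t).trim hm = (μ.withDensity fun ω => ENNReal.ofReal (p ω)).trim hm := by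
  have hint : Integrable p μ := integrable_condExp.congr h
  refine @Measure.ext _ m _ _ fun B hB => ?_
  rw [trim_measurableSet_eq hm hB, trim_measurableSet_eq hm hB,
    Measure.restrict_apply (hm B hB), withDensity_apply _ (hm B hB),
    ← ofReal_integral_eq_lintegral_ofReal hint.integrableOn (ae_of_all _ hp),
    ← setIntegral_congr_ae (g := p) (hm B hB) (h.mono fun ω hω _ => hω),
    setIntegral_condExp hm ((integrable_const _).indicator ht) hB,
    setIntegral_indicator ht, setIntegral_const, smul_eq_mul, mul_one, ofReal_measureReal]

lemma setLIntegral_indicator_eq_of_condExp (hm : m ≤ m0) {t : Set Ω} (ht : MeasurableSet t)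
    {p : Ω → ℝ} (hpm : Measurable p) (hp : ∀ ω, 0 ≤ p ω)
    (h : μ[t.indicator (fun _ => (1 : ℝ)) | m] =ᵐ[μ] p) {s : Set Ω} (hs : MeasurableSet[m] s)
    {g : Ω → ℝ≥0∞} (hg : Measurable[m] g) :
    ∫⁻ ω in s, t.indicator g ω ∂μ = ∫⁻ ω in s, ENNReal.ofReal (p ω) * g ω ∂μ := by
  rw [lintegral_indicator ht, Measure.restrict_comm ht, ← setLIntegral_trim hm hg hs,
    trim_restrict_eq_trim_withDensity_of_condExp hm ht hp h, setLIntegral_trim hm hg hs,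
    restrict_withDensity (hm s hs), lintegral_withDensity_eq_lintegral_mul _ hpm.ennreal_ofReal
      (hg.mono hm le_rfl)]
  rfl

lemma map_restrict_prodMk_of_indep {P E : Type*} [MeasurableSpace P] [mE : MeasurableSpace E]
    (hm : m ≤ m0) {U : Ω → P} (hU : Measurable[m] U) {V : Ω → E} (hV : Measurable V)
    (h : Indep m (mE.comap V) μ) {s : Set Ω} (hs : MeasurableSet[m] s) :
    (μ.restrict s).map (fun ω => (U ω, V ω)) = ((μ.restrict s).map U).prod (μ.map V) := by
  have hUm : Measurable U := hU.mono hm le_rfl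
  refine (Measure.prod_eq fun B C hB hC => ?_).symm
  rw [Measure.map_apply (hUm.prodMk hV) (hB.prod hC), Measure.map_apply hUm hB,
    Measure.map_apply hV hC, Measure.restrict_apply (hUm hB),
    Measure.restrict_apply ((hUm.prodMk hV) (hB.prod hC)),
    ← (Indep_iff _ _ _).1 h _ _ ((hU hB).inter hs) ⟨C, hC, rfl⟩]
  congr 1
  ext ω
  simp only [Set.mem_inter_iff, Set.mem_preimage, Set.mem_prod]
  tauto

end Conditioning

namespace Model

variable {d : ℕ} {𝒳 𝒜 Ω : Type*} [MeasurableSpace 𝒳] [MeasurableSpace 𝒜]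
  {X : ℕ → Ω → 𝒳} {Y : ℕ → Ω → 𝒜 → ℝ} {A : ℕ → Ω → 𝒜}

lemma past_mono : Monotone (past X Y A) := fun _ _ hst =>
  biSup_mono fun _ hr => Finset.Icc_subset_Icc_right hst hr

lemma measurable_past_succ (t : ℕ) :
    Measurable[past X Y A (t + 1)] fun ω => (X (t + 1) ω, A (t + 1) ω, Y (t + 1) ω) := by
  rw [measurable_iff_comap_le]
  exact le_iSup₂_of_le (f := fun s (_ : s ∈ Finset.Icc 1 (t + 1)) =>
    MeasurableSpace.comap (fun ω => (X s ω, A s ω, Y s ω)) inferInstance) (t + 1) (by simp) le_rfl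

lemma measurable_obs_past [Countable 𝒜] [MeasurableSingletonClass 𝒜] (t : ℕ) :
    Measurable[past X Y A (t + 1)] (obs X Y A (t + 1)) :=
  (measurable_observe.comp (by fun_prop : Measurable fun q : 𝒳 × 𝒜 × (𝒜 → ℝ) =>
    ((q.1, q.2.2), q.2.1))).comp (measurable_past_succ t)

lemma measurable_sgd_past [Countable 𝒜] [MeasurableSingletonClass 𝒜] {M : Model d 𝒳 𝒜}
    (hd : ∀ ζ, Differentiable ℝ fun θ => M.loss θ ζ) (η : ℕ → ℝ) (θ₀ : Param d) (t : ℕ) :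
    Measurable[past X Y A t] (M.sgd η θ₀ X Y A t) := by
  induction t with
  | zero => exact measurable_const
  | succ t ih =>
    have hθ : Measurable[past X Y A (t + 1)] (M.sgd η θ₀ X Y A t) :=
      ih.mono (past_mono (Nat.le_succ t)) le_rfl
    have hstep : Measurable fun p : Param d × 𝒳 × 𝒜 × ℝ =>
        p.1 - (η (t + 1) * M.weight p.1 p.2.1 p.2.2.1) • M.gradLoss p.1 p.2 := by
      have := measurable_gradLoss hd
      have := M.measurable_weight_obs
      fun_prop
    exact hstep.comp (hθ.prodMk (measurable_obs_past t))

namespace IsAdaptiveData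

variable [mΩ : MeasurableSpace Ω] {M : Model d 𝒳 𝒜} {η : ℕ → ℝ} {θ₀ : Param d} {μ : Measure Ω}

/-- The filtration of the adaptively collected data. -/
def pastFiltration (h : M.IsAdaptiveData η θ₀ μ X Y A) : Filtration ℕ mΩ where
  seq := past X Y A
  mono' := past_mono
  le' _ := iSup₂_le fun s _ => measurable_iff_comap_le.1
    ((h.measurable_X s).prodMk ((h.measurable_A s).prodMk (h.measurable_Y s)))

variable [MeasurableSingletonClass 𝒜]

lemma measurable_sgd [Countable 𝒜] (h : M.IsAdaptiveData η θ₀ μ X Y A)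
    (hd : ∀ ζ, Differentiable ℝ fun θ => M.loss θ ζ) (t : ℕ) : Measurable (M.sgd η θ₀ X Y A t) :=
  (measurable_sgd_past hd η θ₀ t).mono (h.pastFiltration.le t) le_rfl

variable [IsProbabilityMeasure μ]

lemma setLIntegral_indicator_action [Countable 𝒜] (h : M.IsAdaptiveData η θ₀ μ X Y A)
    (hd : ∀ ζ, Differentiable ℝ fun θ => M.loss θ ζ) (t : ℕ) {s : Set Ω}
    (hs : MeasurableSet[past X Y A t] s) {f : Param d × 𝒳 × 𝒜 × ℝ → ℝ≥0∞} (hf : Measurable f)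
    (a : 𝒜) :
    ∫⁻ ω in s, (A (t + 1) ⁻¹' {a}).indicator
        (fun ω => f (M.sgd η θ₀ X Y A t ω, slot a (X (t + 1) ω, Y (t + 1) ω))) ω ∂μ =
      ∫⁻ ω in s, M.policy (X (t + 1) ω, M.sgd η θ₀ X Y A t ω) {a} *
        f (M.sgd η θ₀ X Y A t ω, slot a (X (t + 1) ω, Y (t + 1) ω)) ∂μ := by
  let E : Ω → 𝒳 × (𝒜 → ℝ) := fun ω => (X (t + 1) ω, Y (t + 1) ω)
  have hle : past X Y A t ⊔ MeasurableSpace.comap E inferInstance ≤ mΩ :=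
    sup_le (h.pastFiltration.le t) ((h.measurable_X _).prodMk (h.measurable_Y _)).comap_le
  have hslot : Measurable[past X Y A t ⊔ MeasurableSpace.comap E inferInstance]
      fun ω => f (M.sgd η θ₀ X Y A t ω, slot a (E ω)) :=
    hf.comp (((measurable_sgd_past hd η θ₀ t).mono le_sup_left le_rfl).prodMk
      ((measurable_slot a).comp ((comap_measurable E).mono le_sup_right le_rfl)))
  have hpol : Measurable fun ω => M.policy (X (t + 1) ω, M.sgd η θ₀ X Y A t ω) {a} :=
    (M.measurable_policy_singleton a).comp ((h.measurable_X _).prodMk (h.measurable_sgd hd t))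
  rw [setLIntegral_indicator_eq_of_condExp hle (h.measurable_A _ (measurableSet_singleton a))
    hpol.ennreal_toReal (fun ω => ENNReal.toReal_nonneg) (h.action t a)
    ((le_sup_left : past X Y A t ≤ _) s hs) hslot]
  simp only [ENNReal.ofReal_toReal (measure_ne_top _ _), E]

lemma setLIntegral_obs [Fintype 𝒜] (h : M.IsAdaptiveData η θ₀ μ X Y A)
    (hd : ∀ ζ, Differentiable ℝ fun θ => M.loss θ ζ) (t : ℕ) {s : Set Ω}
    (hs : MeasurableSet[past X Y A t] s) {f : Param d × 𝒳 × 𝒜 × ℝ → ℝ≥0∞} (hf : Measurable f) :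
    ∫⁻ ω in s, f (M.sgd η θ₀ X Y A t ω, obs X Y A (t + 1) ω) ∂μ =
      ∫⁻ ω in s, ∑ a, M.policy (X (t + 1) ω, M.sgd η θ₀ X Y A t ω) {a} *
        f (M.sgd η θ₀ X Y A t ω, slot a (X (t + 1) ω, Y (t + 1) ω)) ∂μ := by
  have hX := h.measurable_X (t + 1)
  have hY := h.measurable_Y (t + 1)
  have hθ := h.measurable_sgd hd t
  have hsplit (ω : Ω) : f (M.sgd η θ₀ X Y A t ω, obs X Y A (t + 1) ω) =
      ∑ a, (A (t + 1) ⁻¹' {a}).indicator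
        (fun ω => f (M.sgd η θ₀ X Y A t ω, slot a (X (t + 1) ω, Y (t + 1) ω))) ω := by
    rw [Finset.sum_eq_single (A (t + 1) ω) (fun b _ hb =>
      Set.indicator_of_notMem (by simpa using hb.symm) _) (by simp),
      Set.indicator_of_mem (by simp)]
    rfl
  have hslot (a : 𝒜) : Measurable fun ω =>
      f (M.sgd η θ₀ X Y A t ω, slot a (X (t + 1) ω, Y (t + 1) ω)) := by fun_prop
  simp_rw [hsplit]
  rw [lintegral_finsetSum _ fun a _ =>
      (hslot a).indicator (h.measurable_A _ (measurableSet_singleton a)),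
    lintegral_finsetSum _ fun a _ => by fun_prop]
  exact Finset.sum_congr rfl fun a _ => h.setLIntegral_indicator_action hd t hs hf a

theorem isKernelDriven [Finite 𝒜] (h : M.IsAdaptiveData η θ₀ μ X Y A)
    (hd : ∀ ζ, Differentiable ℝ fun θ => M.loss θ ζ) :
    IsKernelDriven μ h.pastFiltration (M.sgd η θ₀ X Y A) (fun t => obs X Y A (t + 1))
      M.obsKernel where
  measurable_param := measurable_sgd_past hd η θ₀
  measurable_obs := measurable_obs_past
  law t s hs := by
    have := Fintype.ofFinite 𝒜
    have hθ := h.measurable_sgd hd t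
    have hEm : Measurable fun ω => (X (t + 1) ω, Y (t + 1) ω) :=
      (h.measurable_X _).prodMk (h.measurable_Y _)
    have hobs : Measurable (obs X Y A (t + 1)) :=
      (measurable_obs_past t).mono (h.pastFiltration.le (t + 1)) le_rfl
    refine Measure.ext_of_lintegral _ fun f hf => ?_
    have hsum : Measurable fun q : Param d × 𝒳 × (𝒜 → ℝ) =>
        ∑ a, M.policy (q.2.1, q.1) {a} * f (q.1, slot a q.2) := by
      fun_prop
    have hκ (θ : Param d) : ∫⁻ z, f (θ, z) ∂(M.obsKernel θ) =
        ∫⁻ p, ∑ a, M.policy (p.1, θ) {a} * f (θ, slot a p) ∂M.env := by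
      rw [obsKernel_apply]
      exact M.lintegral_obsLaw θ (hf.comp measurable_prodMk_left)
    rw [lintegral_map hf (hθ.prodMk hobs), Measure.lintegral_compProd hf,
      h.setLIntegral_obs hd t hs hf]
    simp only [hκ]
    rw [← lintegral_prod _ hsum.aemeasurable, ← h.law t,
      ← map_restrict_prodMk_of_indep (h.pastFiltration.le t)
        (measurable_sgd_past hd η θ₀ t) hEm (h.indep t) hs,
      lintegral_map hsum (hθ.prodMk hEm)]

end IsAdaptiveData

end Model

lemma eq_zero_of_forall_inner_nonneg {E : Type*} [NormedAddCommGroup E] [InnerProductSpace ℝ E]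
    {g : E → E} {p₀ : E} (hg : ContinuousAt g p₀) (h : ∀ p, 0 ≤ inner ℝ (g p) (p - p₀)) :
    g p₀ = 0 := by
  have hline : Tendsto (fun s : ℝ => p₀ - s • g p₀) (𝓝[>] 0) (𝓝 p₀) := by
    simpa using ((by fun_prop : Continuous fun s : ℝ => p₀ - s • g p₀).tendsto 0).mono_left
      nhdsWithin_le_nhds
  have hlim : Tendsto (fun s : ℝ => inner ℝ (g (p₀ - s • g p₀)) (g p₀)) (𝓝[>] 0)
      (𝓝 (inner ℝ (g p₀) (g p₀))) := (hg.tendsto.comp hline).inner tendsto_const_nhds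
  refine real_inner_self_nonpos.1 (le_of_tendsto hlim ?_)
  filter_upwards [self_mem_nhdsWithin] with s hs
  have hs' := h (p₀ - s • g p₀)
  rw [sub_sub_cancel_left, inner_neg_right, inner_smul_right] at hs'
  exact nonpos_of_mul_nonpos_right (neg_nonneg.1 hs') hs

namespace Model

variable {d : ℕ} {𝒳 𝒜 : Type*} [MeasurableSpace 𝒳] [MeasurableSpace 𝒜]
  {M : Model d 𝒳 𝒜} {θstar : Param d} {φ ψ : 𝒳 → ℝ} {C : ℝ}

lemma BoundedWeight.abs_weight_le {wlo whi : ℝ} (h : M.BoundedWeight wlo whi) (θ : Param d)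
    (x : 𝒳) (a : 𝒜) : |M.weight θ x a| ≤ whi :=
  (abs_of_pos (h.pos.trans (h.lower θ x a))).trans_le (h.upper θ x a).le

lemma Shat_apply {Ω : Type*} (η : ℕ → ℝ) (θ₀ : Param d) (X : ℕ → Ω → 𝒳) (Y : ℕ → Ω → 𝒜 → ℝ)
    (A : ℕ → Ω → 𝒜) (n : ℕ) (ω : Ω) (i j : Fin d) :
    M.Shat η θ₀ X Y A n ω i j = cesaro (fun t ω =>
      M.weighted (fun θ z => M.gradLoss θ z i) (M.sgd η θ₀ X Y A t ω) (obs X Y A (t + 1) ω) *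
      M.weighted (fun θ z => M.gradLoss θ z j) (M.sgd η θ₀ X Y A t ω) (obs X Y A (t + 1) ω))
      n ω := by
  simp only [Shat, Matrix.smul_apply, Matrix.sum_apply, smul_eq_mul, outer, Matrix.of_apply,
    weighted, obs, cesaro]
  congr! 2
  ring

lemma Hhat_apply {Ω : Type*} (η : ℕ → ℝ) (θ₀ : Param d) (X : ℕ → Ω → 𝒳) (Y : ℕ → Ω → 𝒜 → ℝ)
    (A : ℕ → Ω → 𝒜) (n : ℕ) (ω : Ω) (i j : Fin d) :
    M.Hhat η θ₀ X Y A n ω i j = cesaro (fun t ω =>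
      M.weighted (fun θ z => M.hessLoss θ z i j) (M.sgd η θ₀ X Y A t ω) (obs X Y A (t + 1) ω))
      n ω := by
  simp only [Hhat, Matrix.smul_apply, Matrix.sum_apply, smul_eq_mul, weighted, obs, cesaro]

lemma S_apply (h : M.gradPopLoss θstar θstar = 0) (i j : Fin d) :
    M.S θstar i j = ∫ z, M.weighted (fun θ z => M.gradLoss θ z i) θstar z *
      M.weighted (fun θ z => M.gradLoss θ z j) θstar z ∂(M.obsLaw θstar) := by
  simp [S, outer, xi, h, weighted]

variable [Fintype 𝒜] [MeasurableSingletonClass 𝒜]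

lemma gradPopLoss_apply (hw : ∀ θ x a, |M.weight θ x a| ≤ C)
    (hd : ∀ ζ, Differentiable ℝ fun θ => M.loss θ ζ)
    (hint : ∀ θ' θ, Integrable (fun ζ => M.weight θ' ζ.1 ζ.2.1 * M.loss θ ζ) (M.obsLaw θ'))
    (hpop : ∀ θ', Differentiable ℝ (M.popLoss θ')) (h4 : M.GradientMoment θstar φ)
    (h5 : M.GradientContinuity θstar φ) (θ' θ : Param d) (i : Fin d) :
    M.gradPopLoss θ' θ i =
      ∫ z, M.weight θ' z.1 z.2.1 * M.gradLoss θ z i ∂(M.obsLaw θ') := by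
  have hk := regularStatistic_gradLoss hd h4 h5 i
  simp only [gradLoss, gradient_apply] at hk
  rw [gradPopLoss, gradient_apply]
  simp only [gradLoss, gradient_apply]
  exact hk.fderiv_integral_weight_mul M.measurable_loss hd hw (hint θ') (hpop θ' θ)

lemma gradPopLoss_eq_integral (hw : ∀ θ x a, |M.weight θ x a| ≤ C)
    (hd : ∀ ζ, Differentiable ℝ fun θ => M.loss θ ζ)
    (hint : ∀ θ' θ, Integrable (fun ζ => M.weight θ' ζ.1 ζ.2.1 * M.loss θ ζ) (M.obsLaw θ'))
    (hpop : ∀ θ', Differentiable ℝ (M.popLoss θ')) (h4 : M.GradientMoment θstar φ)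
    (h5 : M.GradientContinuity θstar φ) (θ' θ : Param d) :
    M.gradPopLoss θ' θ = ∫ z, M.weight θ' z.1 z.2.1 • M.gradLoss θ z ∂(M.obsLaw θ') := by
  ext i
  rw [gradPopLoss_apply hw hd hint hpop h4 h5, eval_integral_piLp fun i =>
    (regularStatistic_gradLoss hd h4 h5 i).integrable_weight_mul hw θ' θ]
  rfl

lemma H_apply (hw : ∀ θ x a, |M.weight θ x a| ≤ C)
    (hint : ∀ θ' θ, Integrable (fun ζ => M.weight θ' ζ.1 ζ.2.1 * M.loss θ ζ) (M.obsLaw θ'))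
    (hpop : ∀ θ', Differentiable ℝ (M.popLoss θ'))
    (hgrad : DifferentiableAt ℝ (M.gradPopLoss θstar) θstar) (h4 : M.GradientMoment θstar φ)
    (h5 : M.GradientContinuity θstar φ) (h6 : M.HessianConditions θstar ψ) (i j : Fin d) :
    M.H θstar i j =
      ∫ z, M.weighted (fun θ z => M.hessLoss θ z i j) θstar z ∂(M.obsLaw θstar) := by
  have hd := h6.differentiable_loss
  have hg := regularStatistic_gradLoss hd h4 h5 i
  have hess (θ : Param d) (z : 𝒳 × 𝒜 × ℝ) : M.hessLoss θ z i j =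
      fderiv ℝ (fun ϑ => M.gradLoss ϑ z i) θ (EuclideanSpace.single j 1) :=
    hessian_apply (h6.differentiable_grad z θ) i j
  have hk := regularStatistic_hessLoss h6 i j
  simp only [hess] at hk
  have hproj : Differentiable ℝ fun θ : Param d => θ i :=
    (EuclideanSpace.proj i : Param d →L[ℝ] ℝ).differentiable
  have hdiff : DifferentiableAt ℝ (fun θ => M.gradPopLoss θstar θ i) θstar :=
    (hproj _).comp θstar hgrad
  simp only [gradPopLoss_apply hw hd hint hpop h4 h5] at hdiff
  calc M.H θstar i j
      = fderiv ℝ (fun θ => M.gradPopLoss θstar θ i) θstar (EuclideanSpace.single j 1) :=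
        hessian_apply hgrad i j
    _ = ∫ z, M.weight θstar z.1 z.2.1 *
          fderiv ℝ (fun ϑ => M.gradLoss ϑ z i) θstar (EuclideanSpace.single j 1)
          ∂(M.obsLaw θstar) := by
        simp only [gradPopLoss_apply hw hd hint hpop h4 h5]
        exact hk.fderiv_integral_weight_mul hg.measurable
          (fun z => hproj.comp (h6.differentiable_grad z)) hw (hg.integrable_weight_mul hw θstar)
          hdiff
    _ = _ := by simp only [weighted, hess]

lemma gradPopLoss_self_eq_zero (hw : ∀ θ x a, |M.weight θ x a| ≤ C)
    (hd : ∀ ζ, Differentiable ℝ fun θ => M.loss θ ζ)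
    (hint : ∀ θ' θ, Integrable (fun ζ => M.weight θ' ζ.1 ζ.2.1 * M.loss θ ζ) (M.obsLaw θ'))
    (hpop : ∀ θ', Differentiable ℝ (M.popLoss θ')) (h4 : M.GradientMoment θstar φ)
    (h5 : M.GradientContinuity θstar φ)
    (hpos : ∀ r R : ℝ, 0 < r → r ≤ R → ∃ c : ℝ, 0 < c ∧ ∀ θ, r ≤ ‖θ - θstar‖ →
      ‖θ - θstar‖ ≤ R → c ≤ inner ℝ (M.gradPopLoss θ θ) (θ - θstar)) :
    M.gradPopLoss θstar θstar = 0 := by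
  refine eq_zero_of_forall_inner_nonneg (g := fun θ => M.gradPopLoss θ θ) ?_
    (inner_nonneg_of_forall_annulus hpos)
  have hcoord : Tendsto (fun θ i => M.gradPopLoss θ θ i) (𝓝 θstar)
      (𝓝 fun i => M.gradPopLoss θstar θstar i) := by
    simp only [tendsto_pi_nhds, gradPopLoss_apply hw hd hint hpop h4 h5]
    exact fun i => (regularStatistic_gradLoss hd h4 h5 i).tendsto_integral_obsLaw_weighted hw
  exact ((PiLp.continuous_toLp 2 fun _ : Fin d => ℝ).tendsto _).comp hcoord

namespace IsAdaptiveData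

variable {Ω : Type*} [MeasurableSpace Ω] {θ₀ : Param d} {η : ℕ → ℝ} {μ : Measure Ω}
  [IsProbabilityMeasure μ] {X : ℕ → Ω → 𝒳} {Y : ℕ → Ω → 𝒜 → ℝ} {A : ℕ → Ω → 𝒜}

theorem ae_tendsto_sgd (h : M.IsAdaptiveData η θ₀ μ X Y A)
    (hw : ∀ θ x a, |M.weight θ x a| ≤ C) (hd : ∀ ζ, Differentiable ℝ fun θ => M.loss θ ζ)
    (hint : ∀ θ' θ, Integrable (fun ζ => M.weight θ' ζ.1 ζ.2.1 * M.loss θ ζ) (M.obsLaw θ'))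
    (hpop : ∀ θ', Differentiable ℝ (M.popLoss θ'))
    (hpos : ∀ r R : ℝ, 0 < r → r ≤ R → ∃ c : ℝ, 0 < c ∧ ∀ θ, r ≤ ‖θ - θstar‖ →
      ‖θ - θstar‖ ≤ R → c ≤ inner ℝ (M.gradPopLoss θ θ) (θ - θstar))
    (h4 : M.GradientMoment θstar φ) (h5 : M.GradientContinuity θstar φ)
    (hη : ∀ t, 1 ≤ t → 0 ≤ η t) (hη_sum : ¬ Summable fun t : ℕ => η (t + 1))
    (hη_sq : Summable fun t : ℕ => η (t + 1) ^ 2) :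
    ∀ᵐ ω ∂μ, Tendsto (fun t => M.sgd η θ₀ X Y A t ω) atTop (𝓝 θstar) := by
  have hg := measurable_gradLoss hd
  have hφ : 0 ≤ ∫ x, φ x ∂M.env.fst := integral_nonneg h4.nonneg
  refine (h.isKernelDriven hd).ae_tendsto_of_inner_pos (γ := fun t => η (t + 1))
    (v := fun θ z => M.weight θ z.1 z.2.1 • M.gradLoss θ z)
    (C := C ^ 2 * (Fintype.card 𝒜 * ∫ x, φ x ∂M.env.fst)) (M.measurable_weight_obs.smul hg)
    (by positivity) (fun θ => ?_) (fun t ω => ?_) (memLp_const θ₀)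
    (fun t => hη _ (Nat.le_add_left 1 t)) hη_sum hη_sq ?_
  · rw [obsKernel_apply]
    exact (lintegral_mono' (M.obsLaw_le_outcomeLaw θ) le_rfl).trans
      (lintegral_enorm_weight_smul_sq_le hw (hg.comp measurable_prodMk_left).enorm h4.nonneg
        h4.integrable (by positivity) (h4.bound.mono fun x hx a => hx a θ) θ)
  · simp only [sgd, obs, mul_smul]
  · simpa only [obsKernel_apply, ← gradPopLoss_eq_integral hw hd hint hpop h4 h5] using hpos

theorem tendstoInMeasure_cesaro_weighted_mul (h : M.IsAdaptiveData η θ₀ μ X Y A)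
    (hw : ∀ θ x a, |M.weight θ x a| ≤ C) (hd : ∀ ζ, Differentiable ℝ fun θ => M.loss θ ζ)
    (hsgd : ∀ᵐ ω ∂μ, Tendsto (fun t => M.sgd η θ₀ X Y A t ω) atTop (𝓝 θstar))
    {k g : Param d → 𝒳 × 𝒜 × ℝ → ℝ} (hk : M.RegularStatistic θstar φ k)
    (hg : IsL2ContinuousAt M.outcomeLaw g θstar) :
    TendstoInMeasure μ (cesaro fun t ω =>
      M.weighted k (M.sgd η θ₀ X Y A t ω) (obs X Y A (t + 1) ω) *
        g (M.sgd η θ₀ X Y A t ω) (obs X Y A (t + 1) ω)) atTop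
      fun _ => ∫ z, M.weighted k θstar z * g θstar z ∂(M.obsLaw θstar) := by
  have hf := hk.isL2ContinuousAt_weighted hw
  have hlln := (h.isKernelDriven hd).tendstoInMeasure_cesaro hsgd (ν := M.outcomeLaw)
    (f := fun θ z => M.weighted k θ z * g θ z)
  simp only [obsKernel_apply] at hlln
  exact hlln M.obsLaw_le_outcomeLaw (hf.measurable.mul hg.measurable)
    (hf.memLp.integrable_mul hg.memLp) (hk.tendsto_lintegral_obsLaw_weighted_mul_sub hw hg)
    (hk.tendsto_integral_obsLaw_weighted_mul hw hg)

end IsAdaptiveData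

end Model

end AdaptiveSGD

theorem proposition1_general {d : ℕ} {𝒳 𝒜 Ω : Type*} [MeasurableSpace 𝒳]
    [Fintype 𝒜] [MeasurableSpace 𝒜] [MeasurableSingletonClass 𝒜] [MeasurableSpace Ω]
    {M : AdaptiveSGD.Model d 𝒳 𝒜} {θstar : AdaptiveSGD.Param d} {C : ℝ} {φ ψ : 𝒳 → ℝ}
    (hw : ∀ θ x a, |M.weight θ x a| ≤ C)
    (hint : ∀ θ' θ, Integrable (fun ζ => M.weight θ' ζ.1 ζ.2.1 * M.loss θ ζ) (M.obsLaw θ'))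
    (hpop : ∀ θ', Differentiable ℝ (M.popLoss θ'))
    (hgrad : DifferentiableAt ℝ (M.gradPopLoss θstar) θstar)
    (hpos : ∀ r R : ℝ, 0 < r → r ≤ R → ∃ c : ℝ, 0 < c ∧ ∀ θ, r ≤ ‖θ - θstar‖ →
      ‖θ - θstar‖ ≤ R → c ≤ inner ℝ (M.gradPopLoss θ θ) (θ - θstar))
    (h4 : M.GradientMoment θstar φ)
    (h5 : M.GradientContinuity θstar φ)
    (h6 : M.HessianConditions θstar ψ)
    {η : ℕ → ℝ} (hη : ∀ t, 1 ≤ t → 0 ≤ η t)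
    (hη_sum : ¬ Summable fun t : ℕ => η (t + 1))
    (hη_sq : Summable fun t : ℕ => η (t + 1) ^ 2)
    {θ₀ : AdaptiveSGD.Param d}
    {μ : Measure Ω} [IsProbabilityMeasure μ]
    {X : ℕ → Ω → 𝒳} {Y : ℕ → Ω → 𝒜 → ℝ} {A : ℕ → Ω → 𝒜}
    (hdata : M.IsAdaptiveData η θ₀ μ X Y A) :
    TendstoInMeasure μ (M.Shat η θ₀ X Y A) atTop (fun _ => M.S θstar) ∧
      TendstoInMeasure μ (M.Hhat η θ₀ X Y A) atTop (fun _ => M.H θstar) := by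
  have hd := h6.differentiable_loss
  have hsgd := hdata.ae_tendsto_sgd hw hd hint hpop hpos h4 h5 hη hη_sum hη_sq
  refine ⟨AdaptiveSGD.tendstoInMeasure_matrix fun i j => ?_,
    AdaptiveSGD.tendstoInMeasure_matrix fun i j => ?_⟩
  · have hki := AdaptiveSGD.Model.regularStatistic_gradLoss hd h4 h5 i
    have hkj := AdaptiveSGD.Model.regularStatistic_gradLoss hd h4 h5 j
    have hzero := AdaptiveSGD.Model.gradPopLoss_self_eq_zero hw hd hint hpop h4 h5 hpos
    rw [AdaptiveSGD.Model.S_apply hzero]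
    simpa only [AdaptiveSGD.Model.Shat_apply] using
      hdata.tendstoInMeasure_cesaro_weighted_mul hw hd hsgd hki (hkj.isL2ContinuousAt_weighted hw)
  · have hk := AdaptiveSGD.Model.regularStatistic_hessLoss h6 i j
    rw [AdaptiveSGD.Model.H_apply hw hint hpop hgrad h4 h5 h6]
    simpa only [AdaptiveSGD.Model.Hhat_apply, mul_one] using
      hdata.tendstoInMeasure_cesaro_weighted_mul hw hd hsgd hk
        (AdaptiveSGD.isL2ContinuousAt_const 1)

theorem proposition1 {d : ℕ} {𝒳 𝒜 Ω : Type*} [MeasurableSpace 𝒳]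
    [Fintype 𝒜] [MeasurableSpace 𝒜] [MeasurableSingletonClass 𝒜] [MeasurableSpace Ω]
    (M : AdaptiveSGD.Model d 𝒳 𝒜) (θstar : AdaptiveSGD.Param d)
    (wlo whi δ lam K : ℝ) (φ ψ : 𝒳 → ℝ)
    (h1 : M.BoundedWeight wlo whi)
    (h2 : M.RegularLoss θstar δ lam)
    (h3 : M.RegularHessian θstar δ K)
    (h4 : M.GradientMoment θstar φ)
    (h5 : M.GradientContinuity θstar φ)
    (h6 : M.HessianConditions θstar ψ)
    (η : ℕ → ℝ) (hη_pos : ∀ t, 1 ≤ t → 0 < η t)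
    (hη_sum : ¬ Summable fun t : ℕ => η (t + 1))
    (hη_sq : Summable fun t : ℕ => η (t + 1) ^ 2)
    (θ₀ : AdaptiveSGD.Param d)
    (μ : Measure Ω) [IsProbabilityMeasure μ]
    (X : ℕ → Ω → 𝒳) (Y : ℕ → Ω → 𝒜 → ℝ) (A : ℕ → Ω → 𝒜)
    (hdata : M.IsAdaptiveData η θ₀ μ X Y A) :
    TendstoInMeasure μ (M.Shat η θ₀ X Y A) atTop (fun _ => M.S θstar) ∧
      TendstoInMeasure μ (M.Hhat η θ₀ X Y A) atTop (fun _ => M.H θstar) :=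
  proposition1_general h1.abs_weight_le h2.integrable
    (fun θ' => (h2.contDiff θ').differentiable one_ne_zero) (h3.differentiable θstar θstar)
    h2.separated h4 h5 h6 (fun t ht => (hη_pos t ht).le) hη_sum hη_sq hdata
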